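/- A hypergraph $H=(V,\mathcal E)$ consists of a finite vertex set $V$ and a finite multiset $\mathcal E$ of subsets of $V$ (its hyperedges). $H$ is $\alpha$-acyclic if it has a join tree, i.e. a tree $T$ with node set $\mathcal E$ such that for every $v\in V$ the hyperedges containing $v$ induce a subtree of $T$ (the graph without nodes counts as a tree). A set $M\subseteq\mathcal E$ is an efficient edge dominating set of $H$ if for every $e\in\mathcal E$ there is exactly one $e'\in M$ with $e\cap e'\ne\emptyset$. The EED problem asks whether a given hypergraph has an efficient edge dominating set. Theorem. For $\alpha$-acyclic hypergraphs, the EED problem is solvable in polynomial time: there are a Turing machine and a polynomial $p$ such that, given any $\alpha$-acyclic hypergraph $H$ (encoded by the number of its vertices in unary followed by the rows of its hyperedge-vertex incidence matrix), the machine halts within $p(N)$ steps, where $N$ is the length of the encoding, and correctly decides whether $H$ has an efficient edge dominating set. -/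

import Mathlib

/-- A hypergraph with vertex set `V` whose hyperedges form a family indexed by `E`.
Since different indices may carry the same subset of `V`, the hyperedges may form a multiset;
the indices `e : E` are the hyperedges as members of that multiset. -/
structure MultiHypergraph (V E : Type*) where
  /-- the set of vertices of each hyperedge -/
  edge : E → Finset V

namespace MultiHypergraph

variable {V E : Type*} (H : MultiHypergraph V E)

/-- The hyperedges `e` and `f` intersect each other, that is, they have a common vertex. -/
def Intersects (e f : E) : Prop :=
  ∃ v : V, v ∈ H.edge e ∧ v ∈ H.edge f

/-- `T` is a join tree of `H`: a tree whose nodes are the hyperedges, such that for every vertex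
`v` the hyperedges containing `v` induce a subtree of `T`. A tree is a connected acyclic graph;
`Preconnected` (any two nodes are joined by a path) is used in place of `Connected` in order to
count the graph without nodes as a tree, both for a hypergraph without hyperedges and for
a vertex that lies in no hyperedge. -/
def IsJoinTree (T : SimpleGraph E) : Prop :=
  T.IsAcyclic ∧ T.Preconnected ∧ ∀ v : V, (T.induce {e : E | v ∈ H.edge e}).Preconnected

/-- A hypergraph is α-acyclic if it has a join tree. -/
def IsAlphaAcyclic : Prop :=
  ∃ T : SimpleGraph E, H.IsJoinTree T

/-- A set `M` of hyperedges is an efficient edge dominating set if every hyperedge is intersected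
by exactly one member of `M`. -/
def IsEfficientEdgeDominating (M : Set E) : Prop :=
  ∀ e : E, ∃! e' : E, e' ∈ M ∧ H.Intersects e' e

/-- `H` has an efficient edge dominating set. -/
def HasEfficientEdgeDominatingSet : Prop :=
  ∃ M : Set E, H.IsEfficientEdgeDominating M

end MultiHypergraph

/-- A finite hypergraph as an input of an algorithm: the vertices are numbered
`0, …, numVerts - 1` and the hyperedges are numbered `0, …, numEdges - 1`. -/
structure HypergraphInstance where
  /-- the number of vertices -/
  numVerts : ℕ
  /-- the number of hyperedges, counted with multiplicity -/
  numEdges : ℕ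
  /-- the hypergraph -/
  graph : MultiHypergraph (Fin numVerts) (Fin numEdges)

namespace HypergraphInstance

/-- The characteristic vector of a set of vertices, as a word of `n` bits. -/
def rowCode {n : ℕ} (s : Finset (Fin n)) : List (Option Bool) :=
  List.ofFn fun v : Fin n => some (decide (v ∈ s))

/-- The input word of a hypergraph over the alphabet `{0, 1, #}` (`#` is `none`): the number of
vertices in unary, followed by `#`, and then the rows of the edge-vertex incidence matrix,
each followed by `#`. -/
def encode (H : HypergraphInstance) : List (Option Bool) :=
  List.replicate H.numVerts (some true) ++ none ::
    (List.ofFn fun e : Fin H.numEdges => rowCode (H.graph.edge e) ++ [none]).flatten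

theorem rowCode_injective {n : ℕ} {s t : Finset (Fin n)} (h : rowCode s = rowCode t) : s = t := by
  have h' := List.ofFn_injective h
  ext v
  simpa using congrFun h' v

/-- The input word determines the hypergraph. -/
theorem encode_injective : Function.Injective encode := by
  have key : ∀ (a b : ℕ) (x y : List (Option Bool)),
      List.replicate a (some true) ++ none :: x = List.replicate b (some true) ++ none :: y →
      a = b ∧ x = y := by
    intro a
    induction a with
    | zero =>
      intro b x y h
      cases b with
      | zero => simpa using h
      | succ b => simp [List.replicate_succ] at h
    | succ a ih =>
      intro b x y h
      cases b with
      | zero => simp [List.replicate_succ] at h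
      | succ b =>
        simp only [List.replicate_succ, List.cons_append, List.cons.injEq, true_and] at h
        obtain ⟨h1, h2⟩ := ih b x y h
        exact ⟨by rw [h1], h2⟩
  have rows : ∀ (n k l : ℕ) (f : Fin k → Finset (Fin n)) (g : Fin l → Finset (Fin n)),
      (List.ofFn fun e => rowCode (f e) ++ [none]).flatten =
        (List.ofFn fun e => rowCode (g e) ++ [none]).flatten → List.ofFn f = List.ofFn g := by
    intro n k
    induction k with
    | zero =>
      intro l f g h
      cases l with
      | zero => simp
      | succ l => simp [List.ofFn_succ] at h
    | succ k ih =>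
      intro l f g h
      cases l with
      | zero => simp [List.ofFn_succ] at h
      | succ l =>
        rw [List.ofFn_succ, List.ofFn_succ, List.flatten_cons, List.flatten_cons] at h
        obtain ⟨h1, h2⟩ := List.append_inj h (by simp [rowCode])
        rw [List.ofFn_succ, List.ofFn_succ, ih l _ _ h2,
          rowCode_injective (List.append_cancel_right h1)]
  rintro ⟨n, k, ⟨f⟩⟩ ⟨n', l, ⟨g⟩⟩ h
  obtain ⟨h1, h2⟩ := key _ _ _ _ h
  dsimp only at h1
  subst h1
  have h3 := rows _ _ _ _ _ h2
  have h4 := congrArg List.length h3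
  simp only [List.length_ofFn] at h4
  subst h4
  have h5 : f = g := List.ofFn_injective h3
  rw [h5]

end HypergraphInstance

open Classical in
/-- The decision problem "does `P a` hold?", restricted to the inputs `a` of the class `C`, is
solvable in polynomial time when the input `a` is presented as the word `enc a`: there are
a (multi-stack) Turing machine and a polynomial `p` such that, for each `a` in the class, the
machine started on `enc a` halts within `p (length of enc a)` steps and outputs the truth value
of `P a`. -/
def SolvableInPolyTimeOn {α Γ : Type} (enc : α → List Γ) (C P : α → Prop) : Prop :=
  Nonempty (Turing.TM2ComputableInPolyTime (fun a : {a : α // C a} => enc a.1)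
    Computability.encodeBool (fun a : {a : α // C a} => decide (P a.1)))

/-! Keep a set `A` of candidate members, initially all hyperedges. If every candidate meeting `f`
also meets `e`, discard the candidates that meet `e` and miss `f`. No efficient edge dominating set
`M` inside `A` loses a member: the member of `M` that meets `f` also meets `e`, so it is the unique
member meeting `e`, and hence no member of `M` meets `e` and misses `f`
(`IsEfficientEdgeDominating.round`). Discarding only shrinks `A`, so as many rounds over all pairs
as there are hyperedges reach a fixed point (`isFixedPt_iterate_of_deflationary`).

At a fixed point, if a candidate `a` meets `e` and misses `f`, some candidate `b` meets `f` and
misses `e`. Seek a dominator `x e` for each node of a join tree such that, for adjacent `e` and `f`,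
a dominator of one that meets the other dominates both. The fixed-point property says that a choice
at one node always extends to a neighbour, so on a tree one admissible choice propagates everywhere
(`IsAcyclic.exists_solution`). The nodes met by a hyperedge `c` form a union of subtrees all passing
through `c`, so local agreement makes `c`, once used, the dominator of every node it meets
(`IsJoinTree.eq_of_intersects`); thus the range of `x` is efficient. A nonempty hypergraph is
therefore a yes-instance exactly when some surviving candidate meets some hyperedge. The join tree
serves only the correctness proof; the algorithm never computes one.

The procedure consists of nested passes over the list of hyperedges. It is written in a small
structured language on stacks, compiled once and for all to a Turing machine (`Run.reaches`,
`computableInPolyTime`). Three copies of the incidence matrix allow independent positions for `e`,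
`f` and the candidate; each program has a specification with an explicit step bound. -/

namespace SimpleGraph

/-! ### Constraint propagation on trees -/

/-- The value at the start of a walk that is obtained by propagating `a` from its end. -/
def Walk.propagate {V α : Type*} {T : SimpleGraph V} (nxt : V → V → α → α) (a : α) :
    ∀ {u v : V}, T.Walk u v → α
  | _, _, .nil => a
  | u, _, .cons (v := w) _ p => nxt w u (p.propagate nxt a)

/-- On a tree, a binary constraint system that is solvable at one node and in which every choice
at a node extends to each neighbour has a solution. -/
theorem IsAcyclic.exists_solution {V α : Type*} {T : SimpleGraph V} (hT : T.IsAcyclic)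
    (hc : T.Preconnected) {D : V → α → Prop} {C : V → V → α → α → Prop}
    (hsymm : ∀ u v a b, C u v a b → C v u b a)
    (hext : ∀ u v a, T.Adj u v → D u a → ∃ b, D v b ∧ C u v a b)
    {r : V} {a₀ : α} (h₀ : D r a₀) :
    ∃ x : V → α, (∀ v, D v (x v)) ∧ ∀ u v, T.Adj u v → C u v (x u) (x v) := by
  classical
  have hnxt : ∀ u v a, ∃ b, T.Adj u v → D u a → D v b ∧ C u v a b := by
    intro u v a
    by_cases h : T.Adj u v ∧ D u a
    · obtain ⟨b, hb⟩ := hext u v a h.1 h.2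
      exact ⟨b, fun _ _ => hb⟩
    -- Off the edges and domains any value will do; this makes `nxt` a total function.
    · exact ⟨a, fun h1 h2 => absurd ⟨h1, h2⟩ h⟩
  choose nxt hnxt using hnxt
  have hval : ∀ {v s : V} (p : T.Walk v s), D s a₀ → D v (p.propagate nxt a₀) := by
    intro v s p h₀
    induction p with
    | nil => exact h₀
    | cons h p ih => exact (hnxt _ _ _ h.symm (ih h₀)).1
  choose p hp using fun v => (hc v r).exists_isPath
  -- Uniqueness of paths in a tree: if `u` is off the path from `v` to the root, then the path from
  -- `u` starts with the edge to `v`, so the value at `u` was computed from that at `v`.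
  have key : ∀ u v (h : T.Adj u v), u ∉ (p v).support →
      C u v ((p u).propagate nxt a₀) ((p v).propagate nxt a₀) := by
    intro u v h hu
    have : p u = Walk.cons h (p v) :=
      congrArg Subtype.val ((hT.subsingleton_path u r).elim ⟨p u, hp u⟩ ⟨_, (hp v).cons hu⟩)
    rw [this]
    exact hsymm _ _ _ _ (hnxt _ _ _ h.symm (hval _ h₀)).2
  refine ⟨fun v => (p v).propagate nxt a₀, fun v => hval _ h₀, fun u v h => ?_⟩
  by_cases hu : u ∈ (p v).support
  · have hv : v ∉ (p u).support := by
      have := hT.ne_mem_support_of_support_of_adj_of_isPath (hp v).reverse (hp u).reverse h.symm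
        (by simpa using hu)
      simpa using this
    exact hsymm _ _ _ _ (key v u h.symm hv)
  · exact key u v h hu

end SimpleGraph

/-! ### Stabilisation of shrinking sets -/

/-- Iterating a deflationary operation on subsets of a finite type at least as often as the type
has elements leads from the full set to a fixed point. -/
theorem isFixedPt_iterate_of_deflationary {E : Type*} [Fintype E]
    (g : (E → Bool) → (E → Bool)) (hg : ∀ A a, g A a = true → A a = true) {k : ℕ}
    (hk : Fintype.card E ≤ k) :
    g (g^[k] fun _ => true) = g^[k] fun _ => true := by
  classical
  -- Until the iteration is stationary, each step removes at least one element.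
  have key : ∀ j, g (g^[j] fun _ => true) = (g^[j] fun _ => true) ∨
      (Finset.univ.filter fun a => (g^[j] fun _ => true) a = true).card + j ≤ Fintype.card E := by
    intro j
    induction j with
    | zero => right; simp
    | succ j ih =>
      rw [Function.iterate_succ_apply']
      rcases ih with ih | ih
      · left; rw [ih, ih]
      · set A := g^[j] fun _ => true
        by_cases h : g A = A
        · left; rw [h, h]
        · right
          have : (Finset.univ.filter fun a => g A a = true).card <
              (Finset.univ.filter fun a => A a = true).card := by
            apply Finset.card_lt_card
            refine Finset.ssubset_iff_subset_ne.mpr ⟨fun a => by simpa using hg A a, fun hne => h ?_⟩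
            funext a
            have := congrArg (a ∈ ·) hne
            simp only [Finset.mem_filter, Finset.mem_univ, true_and, eq_iff_iff] at this
            exact Bool.eq_iff_iff.mpr this
          omega
  rcases key k with h | h
  · exact h
  -- Here the set has become empty, and a deflationary operation fixes the empty set.
  · have h0 : (Finset.univ.filter fun a => (g^[k] fun _ => true) a = true).card = 0 := by omega
    have h1 : ∀ a, (g^[k] fun _ => true) a = false := by simpa [Finset.filter_eq_empty_iff] using h0
    funext a
    rw [h1 a]
    by_contra h2
    have h3 := hg _ a (by simpa using h2)
    rw [h1 a] at h3
    cases h3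

/-! ### The elimination procedure -/

namespace EdgeElimination

variable {E : Type*}

/-- Discard the members of `A` that meet `e` and miss `f`, provided that every member of `A` that
meets `f` also meets `e`. -/
def elim (r : E → E → Bool) (es : List E) (A : E → Bool) (e f : E) : E → Bool :=
  if es.any (fun b => A b && (r b f && !r b e)) then A
  else fun a => A a && !(r a e && !r a f)

/-- One round of eliminations, over all pairs of hyperedges. -/
def round (r : E → E → Bool) (es : List E) (A : E → Bool) : E → Bool :=
  es.foldl (fun A e => es.foldl (fun A f => elim r es A e f) A) A

/-- The verdict that is read off from the remaining hyperedges. -/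
def verdict (r : E → E → Bool) (es : List E) (A : E → Bool) : Bool :=
  es.isEmpty || es.any fun e => es.any fun b => A b && r b e

variable {r : E → E → Bool} {es : List E}

theorem elim_le {A : E → Bool} {e f a : E} (h : elim r es A e f a = true) : A a = true := by
  unfold elim at h
  split_ifs at h
  · exact h
  · simp only [Bool.and_eq_true] at h
    exact h.1

theorem foldl_le {ι : Type*} {s : (E → Bool) → ι → (E → Bool)}
    (hs : ∀ A i a, s A i a = true → A a = true) (l : List ι) {A : E → Bool} {a : E}
    (h : l.foldl s A a = true) : A a = true := by
  induction l generalizing A with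
  | nil => exact h
  | cons i l ih => exact hs _ _ _ (ih h)

/-- Later steps cannot restore what an earlier one removes, so a fold without net effect has no
effect at any step. -/
theorem foldl_fixed {ι : Type*} {s : (E → Bool) → ι → (E → Bool)}
    (hs : ∀ A i a, s A i a = true → A a = true) {l : List ι} {A : E → Bool}
    (h : l.foldl s A = A) {i : ι} (hi : i ∈ l) : s A i = A := by
  induction l with
  | nil => simp at hi
  | cons j l ih =>
    have hj : s A j = A := by
      funext a
      refine Bool.eq_iff_iff.mpr ⟨hs A j a, fun ha => ?_⟩
      rw [← h] at ha
      exact foldl_le hs l ha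
    rw [List.foldl_cons, hj] at h
    rcases List.mem_cons.mp hi with rfl | hi
    · exact hj
    · exact ih h hi

theorem round_le {A : E → Bool} {a : E} (h : round r es A a = true) : A a = true :=
  foldl_le (fun _ _ _ h => foldl_le (fun _ _ _ h => elim_le h) _ h) _ h

theorem elim_eq_of_round_eq {A : E → Bool} (h : round r es A = A) {e f : E} (he : e ∈ es)
    (hf : f ∈ es) : elim r es A e f = A :=
  foldl_fixed (fun _ _ _ h => elim_le h)
    (foldl_fixed (fun _ _ _ h => foldl_le (fun _ _ _ h => elim_le h) _ h) h he) hf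

end EdgeElimination

/-! ### Correctness of elimination on α-acyclic hypergraphs -/

namespace MultiHypergraph

open EdgeElimination

variable {V E : Type*} {H : MultiHypergraph V E}

theorem Intersects.symm {e f : E} (h : H.Intersects e f) : H.Intersects f e := by
  obtain ⟨v, h1, h2⟩ := h
  exact ⟨v, h2, h1⟩

/-- The hyperedges that intersect a given hyperedge `c` induce a connected part of a join tree. -/
theorem IsJoinTree.eq_of_intersects {T : SimpleGraph E} (hT : H.IsJoinTree T) {x : E → E}
    (hx : ∀ u v, T.Adj u v → H.Intersects (x u) v → x v = x u) {c g e : E}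
    (hg : H.Intersects c g) (he : H.Intersects c e) (hc : x g = c) : x e = c := by
  -- Every node of the subtree of a vertex of `c` meets `c`, so the value `c` spreads along its
  -- edges.
  have one : ∀ (v : V), v ∈ H.edge c → ∀ (p q : {e : E | v ∈ H.edge e}),
      (T.induce {e : E | v ∈ H.edge e}).Reachable p q → x p = c → x q = c := by
    rintro v hv p q ⟨w⟩
    induction w with
    | nil => exact id
    | @cons p q _ h _ ih =>
      intro hp
      refine ih ?_
      have := hx p q h (by rw [hp]; exact ⟨v, hv, q.2⟩)
      rw [this, hp]
  obtain ⟨v, hv, hvg⟩ := hg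
  obtain ⟨w, hw, hwe⟩ := he
  -- The node `c` lies in both subtrees, so the value travels from `g` to `c` and on to `e`.
  have h1 : x c = c := one v hv ⟨g, hvg⟩ ⟨c, hv⟩ (hT.2.2 v _ _) hc
  exact one w hw ⟨c, hw⟩ ⟨e, hwe⟩ (hT.2.2 w _ _) h1

/-- A closed set of candidates gives a solvable constraint system on the join tree: keep the
dominator if it meets the neighbour, otherwise switch to the candidate supplied by `hA`. One
admissible pair suffices as a start because the tree is connected. -/
theorem hasEfficientEdgeDominatingSet_of_closed (hH : H.IsAlphaAcyclic) {A : E → Prop}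
    (hA : ∀ e f a, A a → H.Intersects a e → ¬ H.Intersects a f →
      ∃ b, A b ∧ H.Intersects b f ∧ ¬ H.Intersects b e)
    {e₀ b₀ : E} (hb₀ : A b₀) (h₀ : H.Intersects b₀ e₀) : H.HasEfficientEdgeDominatingSet := by
  obtain ⟨T, hT⟩ := hH
  obtain ⟨x, hx, hx'⟩ := hT.1.exists_solution hT.2.1
    (D := fun e a => A a ∧ H.Intersects a e)
    (C := fun e f a b => (H.Intersects a f → b = a) ∧ (H.Intersects b e → a = b))
    (fun u v a b h => ⟨h.2, h.1⟩) (fun e f a _ ha => by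
      by_cases haf : H.Intersects a f
      · exact ⟨a, ⟨ha.1, haf⟩, fun _ => rfl, fun _ => rfl⟩
      · obtain ⟨b, hb, hbf, hbe⟩ := hA e f a ha.1 ha.2 haf
        exact ⟨b, ⟨hb, hbf⟩, fun h => absurd h haf, fun h => absurd h hbe⟩)
    (r := e₀) ⟨hb₀, h₀⟩
  refine ⟨Set.range x, fun e => ⟨x e, ⟨⟨e, rfl⟩, (hx e).2⟩, ?_⟩⟩
  rintro _ ⟨⟨g, rfl⟩, hg⟩
  exact (hT.eq_of_intersects (fun u v h => (hx' u v h).1) (hx g).2 hg rfl).symm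

/-- A round of eliminations keeps the members of every efficient edge dominating set. -/
theorem IsEfficientEdgeDominating.round {M : Set E} (hM : H.IsEfficientEdgeDominating M)
    {r : E → E → Bool} (hr : ∀ e f, r e f = true ↔ H.Intersects e f) {es : List E}
    (hes : ∀ e, e ∈ es) {A : E → Bool} (hA : ∀ a ∈ M, A a = true) :
    ∀ a ∈ M, round r es A a = true := by
  have foldl_inv : ∀ (s : (E → Bool) → E → (E → Bool)),
      (∀ A i, (∀ a ∈ M, A a = true) → ∀ a ∈ M, s A i a = true) → ∀ (l : List E) A,
      (∀ a ∈ M, A a = true) → ∀ a ∈ M, l.foldl s A a = true := by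
    intro s hs l
    induction l with
    | nil => exact fun A h => h
    | cons i l ih => exact fun A h => ih _ (hs A i h)
  refine foldl_inv _ (fun A e hA => foldl_inv _ (fun A f hA a ha => ?_) es A hA) es A hA
  unfold elim
  split_ifs with h
  · exact hA a ha
  · by_contra hc
    simp only [hA a ha, Bool.true_and, Bool.not_eq_true', Bool.and_eq_true,
      hr, ← Bool.not_eq_true] at hc
    rw [not_not] at hc
    -- The member `b` that meets `f` is still alive; as nothing blocks the elimination, it meets `e`
    -- and so coincides with `a`.
    obtain ⟨b, ⟨hb, hbf⟩, -⟩ := hM f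
    have hbe : H.Intersects b e := by
      by_contra hbe
      refine h (List.any_eq_true.mpr ⟨b, hes b, ?_⟩)
      simp [hA b hb, (hr b f).mpr hbf, ← Bool.not_eq_true, hr, hbe]
    have : b = a := (hM e).unique ⟨hb, hbe⟩ ⟨ha, hc.1⟩
    exact hc.2 (this ▸ hbf)

/-- Correctness of the elimination procedure. -/
theorem verdict_eq_true_iff [Fintype E] (hH : H.IsAlphaAcyclic)
    {r : E → E → Bool} (hr : ∀ e f, r e f = true ↔ H.Intersects e f) {es : List E}
    (hes : ∀ e, e ∈ es) {k : ℕ} (hk : Fintype.card E ≤ k) :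
    verdict r es ((EdgeElimination.round r es)^[k] fun _ => true) = true ↔
      H.HasEfficientEdgeDominatingSet := by
  set A := (EdgeElimination.round r es)^[k] fun _ => true with hAdef
  have hfix : EdgeElimination.round r es A = A :=
    isFixedPt_iterate_of_deflationary _ (fun _ _ => round_le) hk
  simp only [verdict, Bool.or_eq_true, List.isEmpty_iff, List.any_eq_true, Bool.and_eq_true, hr]
  constructor
  · rintro (h | ⟨e, -, b, -, hb, hbe⟩)
    · exact ⟨∅, fun e => by simpa [h] using hes e⟩
    · refine hasEfficientEdgeDominatingSet_of_closed hH (A := fun a => A a = true)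
        (fun e f a ha hae haf => ?_) hb hbe
      have h := elim_eq_of_round_eq hfix (hes e) (hes f)
      unfold elim at h
      split_ifs at h with h1
      · obtain ⟨b, -, hb⟩ := List.any_eq_true.mp h1
        simp only [Bool.and_eq_true, hr, Bool.not_eq_true', ← Bool.not_eq_true] at hb
        exact ⟨b, hb.1, hb.2.1, hb.2.2⟩
      · have h2 := congrFun h a
        rw [ha] at h2
        simp only [Bool.true_and, Bool.not_eq_true', ← Bool.not_eq_true, Bool.and_eq_true, hr] at h2
        exact absurd ⟨hae, haf⟩ h2
  · rintro ⟨M, hM⟩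
    have hMA : ∀ a ∈ M, A a = true := by
      have : ∀ j, ∀ a ∈ M, ((EdgeElimination.round r es)^[j] fun _ => true) a = true := by
        intro j
        induction j with
        | zero => simp
        | succ j ih => rw [Function.iterate_succ_apply']; exact hM.round hr hes ih
      exact this k
    rcases es with _ | ⟨e, es⟩
    · exact Or.inl rfl
    · right
      obtain ⟨b, ⟨hb, hbe⟩, -⟩ := hM e
      exact ⟨e, hes e, b, hes b, hMA b hb, hbe⟩

end MultiHypergraph

/-! ### Structured stack programs and their compilation -/

/-- Structured programs that operate on finitely many stacks. -/
inductive StackProg {K : Type} (Γ : K → Type) : Type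
  | push (k : K) (a : Γ k) : StackProg Γ
  | pop (k : K) : StackProg Γ
  | seq (c d : StackProg Γ) : StackProg Γ
  | ite (k : K) (p : Option (Γ k) → Bool) (c d : StackProg Γ) : StackProg Γ
  | loop (k : K) (p : Option (Γ k) → Bool) (c : StackProg Γ) : StackProg Γ

namespace StackProg

open Turing StateTransition

variable {K : Type} {Γ : K → Type} [DecidableEq K]

/-- `Run c s s' t`: started on the stacks `s`, the program `c` stops after `t` steps
with the stacks `s'`. -/
inductive Run : StackProg Γ → (∀ k, List (Γ k)) → (∀ k, List (Γ k)) → ℕ → Prop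
  | push {k a s} : Run (push k a) s (Function.update s k (a :: s k)) 1
  | pop {k s} : Run (pop k) s (Function.update s k (s k).tail) 1
  | seq {c d s s' s'' t t'} : Run c s s' t → Run d s' s'' t' → Run (seq c d) s s'' (t' + t)
  | ite_true {k p c d s s' t} : p (s k).head? = true → Run c s s' t → Run (ite k p c d) s s' (t + 1)
  | ite_false {k p c d s s' t} : p (s k).head? = false → Run d s s' t →
      Run (ite k p c d) s s' (t + 1)
  | loop_false {k p c s} : p (s k).head? = false → Run (loop k p c) s s 1
  | loop_true {k p c s s' s'' t t'} : p (s k).head? = true → Run c s s' t →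
      Run (loop k p c) s' s'' t' → Run (loop k p c) s s'' (t' + (t + 1))

/-- The control points of a program. -/
def Label : StackProg Γ → Type
  | push _ _ => Unit
  | pop _ => Unit
  | seq c d => c.Label ⊕ d.Label
  | ite _ _ c d => Option (c.Label ⊕ d.Label)
  | loop _ _ c => Option c.Label

instance Label.fintype : (c : StackProg Γ) → Fintype c.Label
  | push _ _ => inferInstanceAs (Fintype Unit)
  | pop _ => inferInstanceAs (Fintype Unit)
  | seq c d => @instFintypeSum _ _ (Label.fintype c) (Label.fintype d)
  | ite _ _ c d => @instFintypeOption _ (@instFintypeSum _ _ (Label.fintype c) (Label.fintype d))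
  | loop _ _ c => @instFintypeOption _ (Label.fintype c)

/-- The control point at which a program starts. -/
def start : (c : StackProg Γ) → c.Label
  | push _ _ => ()
  | pop _ => ()
  | seq c _ => Sum.inl c.start
  | ite _ _ _ _ => none
  | loop _ _ _ => none

/-- The instructions of a program whose control points are embedded into `L` and which continues
at `exit`. -/
def code {L : Type} : (c : StackProg Γ) → (c.Label → L) → L → c.Label → TM2.Stmt Γ L Bool
  | push k a, _, exit, _ => .push k (fun _ => a) (.goto fun _ => exit)
  | pop k, _, exit, _ => .pop k (fun x _ => x) (.goto fun _ => exit)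
  | seq c d, emb, _, Sum.inl l =>
      c.code (fun l => emb (Sum.inl l)) (emb (Sum.inr d.start)) l
  | seq _ d, emb, exit, Sum.inr l => d.code (fun l => emb (Sum.inr l)) exit l
  | ite k p c d, emb, _, none => .peek k (fun _ x => p x) (.branch id
      (.goto fun _ => emb (some (Sum.inl c.start))) (.goto fun _ => emb (some (Sum.inr d.start))))
  | ite _ _ c _, emb, exit, some (Sum.inl l) => c.code (fun l => emb (some (Sum.inl l))) exit l
  | ite _ _ _ d, emb, exit, some (Sum.inr l) => d.code (fun l => emb (some (Sum.inr l))) exit l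
  | loop k p c, emb, exit, none => .peek k (fun _ x => p x) (.branch id
      (.goto fun _ => emb (some c.start)) (.goto fun _ => exit))
  | loop _ _ c, emb, _, some l => c.code (fun l => emb (some l)) (emb none) l

/-- Keeping `emb` and `exit` general lets the induction follow a subprogram inside the code of the
whole: the first half of a sequence exits to the second, a loop body to the loop test. The Boolean
state is only scratch space between a peek and the branch after it, hence arbitrary before and
unspecified after. -/
theorem Run.reaches {c : StackProg Γ} {s s' : ∀ k, List (Γ k)} {t : ℕ} (h : Run c s s' t)
    {L : Type} {m : L → TM2.Stmt Γ L Bool} {emb : c.Label → L} {exit : L}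
    (hm : ∀ l, m (emb l) = c.code emb exit l) (v : Bool) :
    ∃ v', (flip bind (TM2.step m))^[t] (some ⟨some (emb c.start), v, s⟩) =
      some ⟨some exit, v', s'⟩ := by
  induction h generalizing v exit with
  | @push k a s =>
    have h0 : m (emb (start (StackProg.push k a))) = .push k (fun _ => a) (.goto fun _ => exit) := hm _
    exact ⟨v, by simp [flip, TM2.step, h0]⟩
  | @pop k s =>
    have h0 : m (emb (start (StackProg.pop k))) = .pop k (fun x _ => x) (.goto fun _ => exit) := hm _
    exact ⟨v, by simp [flip, TM2.step, h0]⟩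
  | @seq c d s s' s'' t t' _ _ ih1 ih2 =>
    obtain ⟨v1, h1⟩ := ih1 (emb := fun l => emb (Sum.inl l)) (exit := emb (Sum.inr d.start))
      (fun l => (hm _).trans rfl) v
    obtain ⟨v2, h2⟩ := ih2 (emb := fun l => emb (Sum.inr l)) (exit := exit)
      (fun l => (hm _).trans rfl) v1
    refine ⟨v2, ?_⟩
    rw [Function.iterate_add_apply]
    exact (congrArg _ h1).trans h2
  | @ite_true k p c d s s' t hp _ ih =>
    have h0 : m (emb (start (ite k p c d))) = .peek k (fun _ x => p x) (.branch id
      (.goto fun _ => emb (some (Sum.inl c.start))) (.goto fun _ => emb (some (Sum.inr d.start)))) := hm _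
    obtain ⟨v1, h1⟩ := ih (emb := fun l => emb (some (Sum.inl l))) (exit := exit)
      (fun l => (hm _).trans rfl) true
    refine ⟨v1, ?_⟩
    rw [Function.iterate_succ_apply, ← h1]
    simp [flip, TM2.step, h0, hp]
  | @ite_false k p c d s s' t hp _ ih =>
    have h0 : m (emb (start (ite k p c d))) = .peek k (fun _ x => p x) (.branch id
      (.goto fun _ => emb (some (Sum.inl c.start))) (.goto fun _ => emb (some (Sum.inr d.start)))) := hm _
    obtain ⟨v1, h1⟩ := ih (emb := fun l => emb (some (Sum.inr l))) (exit := exit)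
      (fun l => (hm _).trans rfl) false
    refine ⟨v1, ?_⟩
    rw [Function.iterate_succ_apply, ← h1]
    simp [flip, TM2.step, h0, hp]
  | @loop_false k p c s hp =>
    have h0 : m (emb (start (loop k p c))) = .peek k (fun _ x => p x) (.branch id
      (.goto fun _ => emb (some c.start)) (.goto fun _ => exit)) := hm _
    refine ⟨false, ?_⟩
    simp [flip, TM2.step, h0, hp]
  | @loop_true k p c s s' s'' t t' hp _ _ ih1 ih2 =>
    have h0 : m (emb (start (loop k p c))) = .peek k (fun _ x => p x) (.branch id
      (.goto fun _ => emb (some c.start)) (.goto fun _ => exit)) := hm _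
    obtain ⟨v1, h1⟩ := ih1 (emb := fun l => emb (some l)) (exit := emb none)
      (fun l => (hm _).trans rfl) true
    obtain ⟨v2, h2⟩ := ih2 hm v1
    refine ⟨v2, ?_⟩
    rw [Function.iterate_add_apply, Function.iterate_succ_apply, ← h2]
    refine congrArg _ (Eq.trans ?_ h1)
    simp [flip, TM2.step, h0, hp]

end StackProg

theorem Turing.initList_eq_update (tm : Turing.FinTM2) (s : List (tm.Γ tm.k₀)) :
    Turing.initList tm s =
      ⟨some tm.main, tm.initialState, Function.update (fun _ => []) tm.k₀ s⟩ := by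
  unfold Turing.initList
  congr 1
  funext k
  by_cases hk : k = tm.k₀
  · subst hk
    rw [Function.update_self, dif_pos rfl]
    rfl
  · rw [Function.update_of_ne hk, dif_neg hk]

theorem Turing.haltList_eq_update (tm : Turing.FinTM2) (s : List (tm.Γ tm.k₁)) :
    Turing.haltList tm s =
      ⟨none, tm.initialState, Function.update (fun _ => []) tm.k₁ s⟩ := by
  unfold Turing.haltList
  congr 1
  funext k
  by_cases hk : k = tm.k₁
  · subst hk
    rw [Function.update_self, dif_pos rfl]
    rfl
  · rw [Function.update_of_ne hk, dif_neg hk]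

namespace StackProg

open Turing StateTransition

variable {K : Type} {Γ : K → Type} [DecidableEq K]

/-- The Turing machine that runs a program. -/
def toFinTM2 [Fintype K] (c : StackProg Γ) (inp out : K) [Fintype (Γ inp)] : FinTM2 where
  K := K
  k₀ := inp
  k₁ := out
  Γ := Γ
  Λ := Option c.Label
  main := some c.start
  σ := Bool
  initialState := false
  m
    -- A halting configuration must carry the initial internal state; this reset costs the extra
    -- step in `time + 1` below.
    | none => .load (fun _ => false) .halt
    | some l => c.code some none l

/-- A program that computes a function in polynomial time gives rise to a Turing machine that
does. -/
theorem computableInPolyTime [Fintype K] {α β αΓ βΓ : Type} {ea : α → List αΓ}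
    {eb : β → List βΓ} {f : α → β} (c : StackProg Γ) (inp out : K) [Fintype (Γ inp)]
    (ei : Γ inp ≃ αΓ) (eo : Γ out ≃ βΓ) (time : Polynomial ℕ)
    (h : ∀ a, ∃ t ≤ time.eval (ea a).length,
      Run c (Function.update (fun _ => []) inp ((ea a).map ei.symm))
        (Function.update (fun _ => []) out ((eb (f a)).map eo.symm)) t) :
    Nonempty (TM2ComputableInPolyTime ea eb f) := by
  refine ⟨{ tm := c.toFinTM2 inp out, inputAlphabet := ei, outputAlphabet := eo,
            time := time + 1, outputsFun := fun a => Classical.choice ?_ }⟩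
  obtain ⟨t, ht, hr⟩ := h a
  obtain ⟨v, hv⟩ := hr.reaches (m := (c.toFinTM2 inp out).m) (emb := some) (exit := none)
    (fun l => rfl) false
  refine ⟨⟨⟨t + 1, ?_⟩, by simpa using ht⟩⟩
  rw [Function.iterate_succ_apply', Option.map_some, initList_eq_update, haltList_eq_update]
  exact (congrArg _ hv).trans rfl

end StackProg

/-! ### Stores and execution rules with step bounds -/

namespace EdgeElimination

open StackProg

/-- The three tapes, each of which holds the list of all hyperedges. -/
inductive Tape
  | e | f | b
  deriving DecidableEq

instance : Fintype Tape := ⟨{.e, .f, .b}, fun x => by cases x <;> simp⟩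

/-- Boolean registers. -/
inductive Flag
  | p | q | g
  deriving DecidableEq

instance : Fintype Flag := ⟨{.p, .q, .g}, fun x => by cases x <;> simp⟩

/-- Tape symbols: incidence bits, and separators that tell whether the hyperedge that follows is
still alive. -/
inductive Cell
  | bit (b : Bool)
  | sep (alive : Bool)

/-- The stacks of the machine; the part of tape `t` to the left of its head is on `lo t` and the
part to the right of it is on `hi t`. -/
inductive Reg
  | inp | out | ctr | lo (t : Tape) | hi (t : Tape) | flag (i : Flag)
  deriving DecidableEq, Fintype

/-- The alphabets of the stacks. -/
abbrev Reg.Sym : Reg → Type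
  | .inp => Option Bool
  | .out => Bool
  | .ctr => Unit
  | .lo _ => Cell
  | .hi _ => Cell
  | .flag _ => Unit

/-- The contents of the stacks. -/
@[ext] structure Store where
  inp : List (Option Bool)
  out : List Bool
  ctr : List Unit
  tape : Tape → List Cell × List Cell
  flag : Flag → Bool

namespace Store

/-- The stacks that represent a store. -/
def regs (S : Store) : ∀ k : Reg, List k.Sym
  | .inp => S.inp
  | .out => S.out
  | .ctr => S.ctr
  | .lo t => (S.tape t).1
  | .hi t => (S.tape t).2
  | .flag i => if S.flag i then [()] else []

/-- Change the contents of a tape. -/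
def setTape (S : Store) (t : Tape) (x : List Cell × List Cell) : Store :=
  { S with tape := Function.update S.tape t x }

/-- Change a flag. -/
def setFlag (S : Store) (i : Flag) (x : Bool) : Store :=
  { S with flag := Function.update S.flag i x }

variable (S : Store)

@[simp] theorem setTape_tape (t : Tape) (x : List Cell × List Cell) :
    (S.setTape t x).tape = Function.update S.tape t x := rfl
@[simp] theorem setTape_flag (t : Tape) (x : List Cell × List Cell) :
    (S.setTape t x).flag = S.flag := rfl
@[simp] theorem setTape_inp (t : Tape) (x : List Cell × List Cell) :
    (S.setTape t x).inp = S.inp := rfl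
@[simp] theorem setTape_out (t : Tape) (x : List Cell × List Cell) :
    (S.setTape t x).out = S.out := rfl
@[simp] theorem setTape_ctr (t : Tape) (x : List Cell × List Cell) :
    (S.setTape t x).ctr = S.ctr := rfl
@[simp] theorem setFlag_tape (i : Flag) (x : Bool) : (S.setFlag i x).tape = S.tape := rfl
@[simp] theorem setFlag_flag (i : Flag) (x : Bool) :
    (S.setFlag i x).flag = Function.update S.flag i x := rfl
@[simp] theorem setFlag_inp (i : Flag) (x : Bool) : (S.setFlag i x).inp = S.inp := rfl
@[simp] theorem setFlag_out (i : Flag) (x : Bool) : (S.setFlag i x).out = S.out := rfl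
@[simp] theorem setFlag_ctr (i : Flag) (x : Bool) : (S.setFlag i x).ctr = S.ctr := rfl

@[simp] theorem setTape_setTape (t : Tape) (x y : List Cell × List Cell) :
    (S.setTape t x).setTape t y = S.setTape t y := by
  ext1 <;> simp

@[simp] theorem setFlag_setFlag (i : Flag) (x y : Bool) :
    (S.setFlag i x).setFlag i y = S.setFlag i y := by
  ext1 <;> simp

theorem setTape_eq_self {t : Tape} {x : List Cell × List Cell} (h : S.tape t = x) :
    S.setTape t x = S := by
  ext1 <;> simp [← h]

theorem setFlag_eq_self {i : Flag} {x : Bool} (h : S.flag i = x) : S.setFlag i x = S := by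
  ext1 <;> simp [← h]

theorem setTape_comm {t u : Tape} (h : t ≠ u) (x y : List Cell × List Cell) :
    (S.setTape t x).setTape u y = (S.setTape u y).setTape t x := by
  ext1 <;> simp [Function.update_comm h]

theorem setFlag_setTape (i : Flag) (v : Bool) (t : Tape) (x : List Cell × List Cell) :
    (S.setFlag i v).setTape t x = (S.setTape t x).setFlag i v := rfl

theorem update_inp (x : List (Option Bool)) :
    Function.update S.regs .inp x = { S with inp := x }.regs := by
  funext r
  cases r <;> simp [regs, Function.update]

theorem update_out (x : List Bool) :
    Function.update S.regs .out x = { S with out := x }.regs := by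
  funext r
  cases r <;> simp [regs, Function.update]

theorem update_ctr (x : List Unit) :
    Function.update S.regs .ctr x = { S with ctr := x }.regs := by
  funext r
  cases r <;> simp [regs, Function.update]

theorem update_lo (t : Tape) (x : List Cell) :
    Function.update S.regs (.lo t) x = (S.setTape t (x, (S.tape t).2)).regs := by
  funext r
  cases r with
  | lo u =>
    by_cases h : u = t
    · subst h; simp [regs]
    · simp [regs, h]
  | hi u =>
    by_cases h : u = t
    · subst h; simp [regs]
    · simp [regs, h]
  | flag u => simp [regs, Function.update]; rfl
  | _ => simp [regs, Function.update]

theorem update_hi (t : Tape) (x : List Cell) :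
    Function.update S.regs (.hi t) x = (S.setTape t ((S.tape t).1, x)).regs := by
  funext r
  cases r with
  | lo u =>
    by_cases h : u = t
    · subst h; simp [regs]
    · simp [regs, h]
  | hi u =>
    by_cases h : u = t
    · subst h; simp [regs]
    · simp [regs, h]
  | flag u => simp [regs, Function.update]; rfl
  | _ => simp [regs, Function.update]

theorem update_flag (i : Flag) (x : Bool) :
    Function.update S.regs (.flag i) (if x then [()] else []) = (S.setFlag i x).regs := by
  funext r
  cases r with
  | flag u =>
    by_cases h : u = i
    · subst h; simp [regs]
    · simp [regs, h]
  | _ => simp [regs, Function.update]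

end Store

/-- Programs for the elimination machine. -/
abbrev Prog : Type := StackProg Reg.Sym

/-- Started in the store `S`, the program `c` stops in the store `S'` after at most `T` steps. -/
def Exec (c : Prog) (S S' : Store) (T : ℕ) : Prop :=
  ∃ t ≤ T, Run c S.regs S'.regs t

section Exec

variable {c d : Prog} {S S' S'' : Store} {T T' : ℕ}

theorem Exec.mono (h : Exec c S S' T) (hT : T ≤ T') : Exec c S S' T' := by
  obtain ⟨t, ht, h⟩ := h
  exact ⟨t, ht.trans hT, h⟩

theorem Exec.seq (h : Exec c S S' T) (h' : Exec d S' S'' T') : Exec (.seq c d) S S'' (T + T') := by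
  obtain ⟨t, ht, h⟩ := h
  obtain ⟨t', ht', h'⟩ := h'
  exact ⟨_, by omega, h.seq h'⟩

theorem Exec.ite_true {k : Reg} {p : Option k.Sym → Bool} (hp : p (S.regs k).head? = true)
    (h : Exec c S S' T) : Exec (.ite k p c d) S S' (T + 1) := by
  obtain ⟨t, ht, h⟩ := h
  exact ⟨_, by omega, h.ite_true hp⟩

theorem Exec.ite_false {k : Reg} {p : Option k.Sym → Bool} (hp : p (S.regs k).head? = false)
    (h : Exec d S S' T) : Exec (.ite k p c d) S S' (T + 1) := by
  obtain ⟨t, ht, h⟩ := h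
  exact ⟨_, by omega, h.ite_false hp⟩

theorem Exec.loop_false {k : Reg} {p : Option k.Sym → Bool}
    (hp : p (S.regs k).head? = false) : Exec (.loop k p c) S S 1 :=
  ⟨1, le_rfl, .loop_false hp⟩

theorem Exec.loop_true {k : Reg} {p : Option k.Sym → Bool} (hp : p (S.regs k).head? = true)
    (h : Exec c S S' T) (h' : Exec (.loop k p c) S' S'' T') :
    Exec (.loop k p c) S S'' (T + T' + 1) := by
  obtain ⟨t, ht, h⟩ := h
  obtain ⟨t', ht', h'⟩ := h'
  exact ⟨_, by omega, h.loop_true hp h'⟩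

theorem exec_of_run {s : ∀ k : Reg, List k.Sym} {t : ℕ} (h : Run c S.regs s t)
    (hs : s = S'.regs) : Exec c S S' t :=
  ⟨t, le_rfl, hs ▸ h⟩

theorem exec_pop_inp : Exec (.pop .inp) S { S with inp := S.inp.tail } 1 :=
  exec_of_run Run.pop (S.update_inp _)

theorem exec_push_out (x : Bool) : Exec (.push .out x) S { S with out := x :: S.out } 1 :=
  exec_of_run Run.push (S.update_out _)

theorem exec_pop_ctr : Exec (.pop .ctr) S { S with ctr := S.ctr.tail } 1 :=
  exec_of_run Run.pop (S.update_ctr _)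

theorem exec_push_ctr : Exec (.push .ctr ()) S { S with ctr := () :: S.ctr } 1 :=
  exec_of_run Run.push (S.update_ctr _)

theorem exec_pop_lo (t : Tape) :
    Exec (.pop (.lo t)) S (S.setTape t ((S.tape t).1.tail, (S.tape t).2)) 1 :=
  exec_of_run Run.pop (S.update_lo t _)

theorem exec_push_lo (t : Tape) (c : Cell) :
    Exec (.push (.lo t) c) S (S.setTape t (c :: (S.tape t).1, (S.tape t).2)) 1 :=
  exec_of_run Run.push (S.update_lo t _)

theorem exec_pop_hi (t : Tape) :
    Exec (.pop (.hi t)) S (S.setTape t ((S.tape t).1, (S.tape t).2.tail)) 1 :=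
  exec_of_run Run.pop (S.update_hi t _)

theorem exec_push_hi (t : Tape) (c : Cell) :
    Exec (.push (.hi t) c) S (S.setTape t ((S.tape t).1, c :: (S.tape t).2)) 1 :=
  exec_of_run Run.push (S.update_hi t _)

/-- The program that does nothing. -/
def skip : Prog := .loop .inp (fun _ => false) (.pop .inp)

theorem exec_skip : Exec skip S S 1 := .loop_false rfl

/-- Lower a flag. -/
def clear (i : Flag) : Prog := .pop (.flag i)

/-- Popping an empty stack does nothing, so the flag need not be raised beforehand. -/
theorem exec_clear (i : Flag) : Exec (clear i) S (S.setFlag i false) 1 := by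
  refine ⟨1, le_rfl, ?_⟩
  rw [← S.update_flag]
  have : (if false = true then [()] else []) = (S.regs (.flag i)).tail := by
    simp only [Store.regs]
    split_ifs <;> simp_all
  rw [this]
  exact Run.pop

/-- Raise a flag. -/
def raise (i : Flag) : Prog := .loop (.flag i) Option.isNone (.push (.flag i) ())

/-- The loop acts as a conditional: a push falsifies its test, so a flag stack never holds more than
one token. -/
theorem exec_raise (i : Flag) : Exec (raise i) S (S.setFlag i true) 3 := by
  cases h : S.flag i with
  | true =>
    rw [S.setFlag_eq_self h]
    exact (Exec.loop_false (by simp [Store.regs, h])).mono (by norm_num)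
  | false =>
    have h1 : Exec (.push (.flag i) ()) S (S.setFlag i true) 1 := by
      refine ⟨1, le_rfl, ?_⟩
      rw [← S.update_flag]
      have : (if true = true then [()] else []) = () :: (S.regs (.flag i)) := by
        simp [Store.regs, h]
      rw [this]
      exact Run.push
    exact Exec.loop_true (by simp [Store.regs, h]) h1
      (Exec.loop_false (by simp [Store.regs]))

end Exec

/-- A conditional on a flag. -/
def ifFlag (i : Flag) (c d : Prog) : Prog := .ite (.flag i) Option.isSome c d

theorem exec_ifFlag {i : Flag} {c d : Prog} {S S' : Store} {T : ℕ}
    (h : Exec (if S.flag i then c else d) S S' T) : Exec (ifFlag i c d) S S' (T + 1) := by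
  cases hi : S.flag i with
  | true => exact .ite_true (by simp [Store.regs, hi]) (by simpa [hi] using h)
  | false => exact .ite_false (by simp [Store.regs, hi]) (by simpa [hi] using h)

/-! ### Head movements on a tape -/

/-- The symbol is an incidence bit. -/
def isBit : Option Cell → Bool
  | some (.bit _) => true
  | _ => false

/-- The symbol is the given incidence bit. -/
def isBitEq (b : Bool) : Option Cell → Bool
  | some (.bit b') => b == b'
  | _ => false

/-- The symbol is the separator in front of a hyperedge that is alive. -/
def isAlive : Option Cell → Bool
  | some (.sep b) => b
  | _ => false

/-- Branch according to the symbol on top of a stack of cells. -/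
def caseCell (k : Reg) (h : k.Sym = Cell) (c : Cell → Prog) : Prog :=
  .ite k (fun x => isBitEq false (h ▸ x)) (c (.bit false))
    (.ite k (fun x => isBitEq true (h ▸ x)) (c (.bit true))
      -- The last branch also catches an empty stack; the specifications of the moves exclude that
      -- case.
      (.ite k (fun x => isAlive (h ▸ x)) (c (.sep true)) (c (.sep false))))

/-- Move the head of tape `t` forwards. -/
def fwd (t : Tape) : Prog :=
  caseCell (.hi t) rfl fun c => .seq (.pop (.hi t)) (.push (.lo t) c)

/-- Move the head of tape `t` backwards. -/
def bwd (t : Tape) : Prog :=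
  caseCell (.lo t) rfl fun c => .seq (.pop (.lo t)) (.push (.hi t) c)

section Moves

variable {t : Tape} {S : Store} {l h : List Cell} {c : Cell}

theorem exec_fwd (hS : S.tape t = (l, c :: h)) : Exec (fwd t) S (S.setTape t (c :: l, h)) 5 := by
  have h1 : ∀ c', c' = c → Exec (.seq (.pop (.hi t)) (.push (.lo t) c')) S
      (S.setTape t (c :: l, h)) 2 := by
    intro c' hc
    rw [hc]
    have := (exec_pop_hi (S := S) t).seq (exec_push_lo t c)
    simpa [hS] using this
  have h2 : (S.regs (.hi t)).head? = some c := by simp [Store.regs, hS]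
  unfold fwd caseCell
  rcases c with (_ | _) | (_ | _)
  · exact (Exec.ite_true (by rw [h2]; rfl) (h1 _ rfl)).mono (by norm_num)
  · exact (Exec.ite_false (by rw [h2]; rfl) (.ite_true (by rw [h2]; rfl) (h1 _ rfl))).mono
      (by norm_num)
  · exact .ite_false (by rw [h2]; rfl) (.ite_false (by rw [h2]; rfl)
      (.ite_false (by rw [h2]; rfl) (h1 _ rfl)))
  · exact .ite_false (by rw [h2]; rfl) (.ite_false (by rw [h2]; rfl)
      (.ite_true (by rw [h2]; rfl) (h1 _ rfl)))

theorem exec_bwd (hS : S.tape t = (c :: l, h)) : Exec (bwd t) S (S.setTape t (l, c :: h)) 5 := by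
  have h1 : ∀ c', c' = c → Exec (.seq (.pop (.lo t)) (.push (.hi t) c')) S
      (S.setTape t (l, c :: h)) 2 := by
    intro c' hc
    rw [hc]
    have := (exec_pop_lo (S := S) t).seq (exec_push_hi t c)
    simpa [hS] using this
  have h2 : (S.regs (.lo t)).head? = some c := by simp [Store.regs, hS]
  unfold bwd caseCell
  rcases c with (_ | _) | (_ | _)
  · exact (Exec.ite_true (by rw [h2]; rfl) (h1 _ rfl)).mono (by norm_num)
  · exact (Exec.ite_false (by rw [h2]; rfl) (.ite_true (by rw [h2]; rfl) (h1 _ rfl))).mono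
      (by norm_num)
  · exact .ite_false (by rw [h2]; rfl) (.ite_false (by rw [h2]; rfl)
      (.ite_false (by rw [h2]; rfl) (h1 _ rfl)))
  · exact .ite_false (by rw [h2]; rfl) (.ite_false (by rw [h2]; rfl)
      (.ite_true (by rw [h2]; rfl) (h1 _ rfl)))

/-- Move the head of tape `t` forwards over incidence bits. -/
def fwdBits (t : Tape) : Prog := .loop (.hi t) isBit (fwd t)

/-- Move the head of tape `t` backwards over incidence bits. -/
def bwdBits (t : Tape) : Prog := .loop (.lo t) isBit (bwd t)

/-- Move the head of tape `t` to the left end. -/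
def rewind (t : Tape) : Prog := .loop (.lo t) Option.isSome (bwd t)

/-- The hypothesis on `X` stops the loop exactly at the end of the block; each bit costs 5 steps for
the move and 1 for the test. -/
theorem exec_fwdBits (bs : List Bool) {X : List Cell} (hX : isBit X.head? = false)
    (hS : S.tape t = (l, bs.map Cell.bit ++ X)) :
    Exec (fwdBits t) S (S.setTape t ((bs.map Cell.bit).reverse ++ l, X)) (6 * bs.length + 1) := by
  induction bs generalizing S l with
  | nil =>
    have := S.setTape_eq_self hS
    simp only [List.map_nil, List.nil_append, List.reverse_nil] at this hS ⊢
    rw [this]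
    exact Exec.loop_false (by simpa [Store.regs, hS] using hX)
  | cons b bs ih =>
    have h1 := exec_fwd (S := S) (t := t) (l := l) (c := .bit b) (h := bs.map Cell.bit ++ X) hS
    have h2 := ih (S := S.setTape t (.bit b :: l, bs.map Cell.bit ++ X)) (l := .bit b :: l) (by simp)
    rw [Store.setTape_setTape] at h2
    have h3 := Exec.loop_true (p := isBit) (k := .hi t) (by simp [Store.regs, hS, isBit]) h1 h2
    simp only [List.map_cons, List.reverse_cons, List.append_assoc, List.cons_append,
      List.nil_append, List.length_cons]
    exact h3.mono (by omega)

theorem exec_bwdBits (bs : List Bool) {X : List Cell} (hX : isBit X.head? = false)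
    (hS : S.tape t = (bs.map Cell.bit ++ X, h)) :
    Exec (bwdBits t) S (S.setTape t (X, (bs.map Cell.bit).reverse ++ h)) (6 * bs.length + 1) := by
  induction bs generalizing S h with
  | nil =>
    have := S.setTape_eq_self hS
    simp only [List.map_nil, List.nil_append, List.reverse_nil] at this hS ⊢
    rw [this]
    exact Exec.loop_false (by simpa [Store.regs, hS] using hX)
  | cons b bs ih =>
    have h1 := exec_bwd (S := S) (t := t) (h := h) (c := .bit b) (l := bs.map Cell.bit ++ X) hS
    have h2 := ih (S := S.setTape t (bs.map Cell.bit ++ X, .bit b :: h)) (h := .bit b :: h) (by simp)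
    rw [Store.setTape_setTape] at h2
    have h3 := Exec.loop_true (p := isBit) (k := .lo t) (by simp [Store.regs, hS, isBit]) h1 h2
    simp only [List.map_cons, List.reverse_cons, List.append_assoc, List.cons_append,
      List.nil_append, List.length_cons]
    exact h3.mono (by omega)

theorem exec_rewind (hS : S.tape t = (l, h)) :
    Exec (rewind t) S (S.setTape t ([], l.reverse ++ h)) (6 * l.length + 1) := by
  induction l generalizing S h with
  | nil =>
    have := S.setTape_eq_self hS
    simp only [List.nil_append, List.reverse_nil]
    rw [this]
    exact Exec.loop_false (by simp [Store.regs, hS])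
  | cons c l ih =>
    have h1 := exec_bwd hS
    have h2 := ih (S := S.setTape t (l, c :: h)) (h := c :: h) (by simp)
    rw [Store.setTape_setTape] at h2
    have h3 := Exec.loop_true (p := Option.isSome) (k := .lo t) (by simp [Store.regs, hS]) h1 h2
    simp only [List.reverse_cons, List.append_assoc, List.cons_append, List.nil_append,
      List.length_cons]
    exact h3.mono (by omega)

end Moves

/-! ### Layout of the hyperedges on a tape -/

/-- The word for a hyperedge on a tape: a separator that tells whether it is alive, followed by
its incidence bits. -/
def cells (r : Bool × List Bool) : List Cell := .sep r.1 :: r.2.map Cell.bit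

/-- The word for a list of hyperedges to the right of the head. -/
def ahead (rs : List (Bool × List Bool)) : List Cell := rs.flatMap cells

/-- The word for a list of hyperedges to the left of the head, the nearest one first. -/
def behind (rs : List (Bool × List Bool)) : List Cell := rs.flatMap fun r => (cells r).reverse

theorem isBit_head?_ahead (rs : List (Bool × List Bool)) : isBit (ahead rs).head? = false := by
  cases rs <;> rfl

/-- Move the head of tape `t` to the next hyperedge. -/
def nextRow (t : Tape) : Prog := .seq (fwd t) (fwdBits t)

/-- Move the head of tape `t` to the previous hyperedge. -/
def prevRow (t : Tape) : Prog := .seq (bwdBits t) (bwd t)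

section Rows

variable {t : Tape} {S : Store} {l h : List Cell} {r : Bool × List Bool}

theorem exec_nextRow (hh : isBit h.head? = false) (hS : S.tape t = (l, cells r ++ h)) :
    Exec (nextRow t) S (S.setTape t ((cells r).reverse ++ l, h)) (6 * r.2.length + 6) := by
  have h1 := exec_fwd (S := S) (t := t) (l := l) (c := .sep r.1) (h := r.2.map Cell.bit ++ h) hS
  have h2 := exec_fwdBits (S := S.setTape t (.sep r.1 :: l, r.2.map Cell.bit ++ h)) (t := t) r.2 hh
    (l := .sep r.1 :: l) (by simp)
  have h3 := h1.seq h2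
  rw [Store.setTape_setTape] at h3
  simp only [cells, List.reverse_cons, List.append_assoc, List.cons_append, List.nil_append]
  exact h3.mono (by omega)

theorem exec_prevRow (hS : S.tape t = ((cells r).reverse ++ l, h)) :
    Exec (prevRow t) S (S.setTape t (l, cells r ++ h)) (6 * r.2.length + 6) := by
  -- To the left of the head the bits are stacked in reverse order.
  have h1 := exec_bwdBits (S := S) (t := t) r.2.reverse (X := .sep r.1 :: l) (h := h) rfl
    (by simp [hS, cells])
  have h2 := exec_bwd (S := S.setTape t (.sep r.1 :: l, (r.2.reverse.map Cell.bit).reverse ++ h))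
    (t := t) (c := .sep r.1) (l := l) (h := (r.2.reverse.map Cell.bit).reverse ++ h) (by simp)
  have h3 := h1.seq h2
  rw [Store.setTape_setTape] at h3
  simp only [List.map_reverse, List.reverse_reverse, List.length_reverse] at h3
  exact h3

end Rows

/-! ### Testing whether two hyperedges intersect -/

/-- Two bit vectors have a common one. -/
def meetBits : List Bool → List Bool → Bool
  | a :: as, b :: bs => (a && b) || meetBits as bs
  | _, _ => false

/-- The body of the loop that compares two hyperedges bit by bit. -/
def meetsBody (x y : Tape) (i : Flag) : Prog :=
  .seq (.ite (.hi x) (isBitEq true) (.ite (.hi y) (isBitEq true) (raise i) skip) skip)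
    (.seq (fwd x) (fwd y))

/-- Set flag `i` to tell whether the current hyperedges of the tapes `x` and `y` intersect. -/
def meets (x y : Tape) (i : Flag) : Prog :=
  .seq (fwd x) <| .seq (fwd y) <| .seq (clear i) <|
    .seq (.loop (.hi x) isBit (meetsBody x y i)) <| .seq (prevRow x) (prevRow y)

section Meets

variable {x y : Tape} {i : Flag} {S : Store} {lx ly hx hy : List Cell}

theorem exec_meetsBody (hxy : x ≠ y) {a b : Bool} (hSx : S.tape x = (lx, .bit a :: hx))
    (hSy : S.tape y = (ly, .bit b :: hy)) :
    Exec (meetsBody x y i) S (((S.setTape x (.bit a :: lx, hx)).setTape y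
      (.bit b :: ly, hy)).setFlag i (S.flag i || (a && b))) 15 := by
  have h1 : Exec (.ite (.hi x) (isBitEq true) (.ite (.hi y) (isBitEq true) (raise i) skip) skip) S
      (S.setFlag i (S.flag i || (a && b))) 5 := by
    have hx' : (S.regs (.hi x)).head? = some (.bit a) := by simp [Store.regs, hSx]
    have hy' : (S.regs (.hi y)).head? = some (.bit b) := by simp [Store.regs, hSy]
    cases a with
    | false =>
      rw [S.setFlag_eq_self (by simp)]
      exact (Exec.ite_false (by rw [hx']; rfl) exec_skip).mono (by norm_num)
    | true =>
      cases b with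
      | false =>
        rw [S.setFlag_eq_self (by simp)]
        exact (Exec.ite_true (by rw [hx']; rfl)
          (.ite_false (by rw [hy']; rfl) exec_skip)).mono (by norm_num)
      | true =>
        rw [Bool.and_self, Bool.or_true]
        exact Exec.ite_true (by rw [hx']; rfl) (.ite_true (by rw [hy']; rfl) (exec_raise i))
  set v := S.flag i || (a && b)
  have h2 := exec_fwd (S := S.setFlag i v) (t := x) (l := lx) (c := .bit a) (h := hx) (by simpa)
  have h3 := exec_fwd (S := (S.setFlag i v).setTape x (.bit a :: lx, hx)) (t := y) (l := ly)
    (c := .bit b) (h := hy) (by simpa [hxy.symm])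
  exact h1.seq (h2.seq h3)

theorem exec_meetsLoop (hxy : x ≠ y) (as bs : List Bool) (hlen : as.length = bs.length)
    {X Y : List Cell} (hX : isBit X.head? = false)
    (hSx : S.tape x = (lx, as.map Cell.bit ++ X)) (hSy : S.tape y = (ly, bs.map Cell.bit ++ Y)) :
    Exec (.loop (.hi x) isBit (meetsBody x y i)) S
      (((S.setTape x ((as.map Cell.bit).reverse ++ lx, X)).setTape y
        ((bs.map Cell.bit).reverse ++ ly, Y)).setFlag i (S.flag i || meetBits as bs))
      (16 * as.length + 1) := by
  induction as generalizing S lx ly bs with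
  | nil =>
    cases bs with
    | cons => simp at hlen
    | nil =>
      have : ((S.setTape x (lx, X)).setTape y (ly, Y)).setFlag i (S.flag i) = S := by
        rw [S.setTape_eq_self (by simpa using hSx), S.setTape_eq_self (by simpa using hSy),
          S.setFlag_eq_self rfl]
      simp only [List.map_nil, List.nil_append, List.reverse_nil, meetBits, Bool.or_false]
      rw [this]
      exact Exec.loop_false (by simpa [Store.regs, hSx] using hX)
  | cons a as ih =>
    cases bs with
    | nil => simp at hlen
    | cons b bs =>
      have h1 := exec_meetsBody (i := i) hxy (S := S) (a := a) (b := b) hSx hSy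
      have h2 := ih (S := ((S.setTape x (.bit a :: lx, as.map Cell.bit ++ X)).setTape y
        (.bit b :: ly, bs.map Cell.bit ++ Y)).setFlag i (S.flag i || (a && b)))
        (lx := .bit a :: lx) (ly := .bit b :: ly) bs (by simpa using hlen)
        (by simp [hxy]) (by simp)
      have h3 := Exec.loop_true (p := isBit) (k := .hi x) (by simp [Store.regs, hSx, isBit]) h1 h2
      rw [Store.setFlag_setTape, Store.setFlag_setTape, Store.setFlag_setFlag,
        Store.setTape_comm _ hxy.symm, Store.setTape_setTape, Store.setTape_setTape] at h3
      simp only [Store.setFlag_flag, Function.update_self] at h3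
      simp only [List.map_cons, List.reverse_cons, List.append_assoc, List.cons_append,
        List.nil_append, List.length_cons, meetBits, ← Bool.or_assoc]
      exact h3.mono (by omega)

/-- Both heads return to the start of their rows, so only the flag changes. The loop watches tape
`x` alone; equal row lengths keep tape `y` in step. -/
theorem exec_meets (hxy : x ≠ y) {r r' : Bool × List Bool} (hlen : r.2.length = r'.2.length)
    (hhx : isBit hx.head? = false) (hSx : S.tape x = (lx, cells r ++ hx))
    (hSy : S.tape y = (ly, cells r' ++ hy)) :
    Exec (meets x y i) S (S.setFlag i (meetBits r.2 r'.2)) (28 * r.2.length + 24) := by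
  have h1 := exec_fwd (S := S) (t := x) (l := lx) (c := .sep r.1) (h := r.2.map Cell.bit ++ hx) hSx
  set S1 := S.setTape x (.sep r.1 :: lx, r.2.map Cell.bit ++ hx) with hS1
  have h2 := exec_fwd (S := S1) (t := y) (l := ly) (c := .sep r'.1) (h := r'.2.map Cell.bit ++ hy)
    (by rw [hS1, Store.setTape_tape, Function.update_of_ne hxy.symm]; exact hSy)
  set S2 := S1.setTape y (.sep r'.1 :: ly, r'.2.map Cell.bit ++ hy) with hS2
  have h3 := exec_clear (S := S2) i
  have h4 := exec_meetsLoop (S := S2.setFlag i false) (i := i) hxy r.2 r'.2 hlen (X := hx) (Y := hy)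
    hhx (lx := .sep r.1 :: lx) (ly := .sep r'.1 :: ly) (by simp [hS2, hS1, hxy]) (by simp [hS2])
  set S3 := S2.setTape x ((cells r).reverse ++ lx, hx) with hS3
  set S4 := S3.setTape y ((cells r').reverse ++ ly, hy) with hS4
  have h6 : Exec (prevRow x) (S4.setFlag i (meetBits r.2 r'.2)) _ _ :=
    exec_prevRow (r := r) (l := lx) (h := hx) (by simp [hS4, hS3, hxy])
  have h7 := exec_prevRow (S := (S4.setFlag i (meetBits r.2 r'.2)).setTape x (lx, cells r ++ hx))
    (t := y) (r := r') (l := ly) (h := hy) (by simp [hS4, hxy.symm])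
  have h8 : (((S2.setFlag i false).setTape x ((r.2.map Cell.bit).reverse ++ .sep r.1 :: lx, hx)).setTape
      y ((r'.2.map Cell.bit).reverse ++ .sep r'.1 :: ly, hy)).setFlag i
      ((S2.setFlag i false).flag i || meetBits r.2 r'.2) = S4.setFlag i (meetBits r.2 r'.2) := by
    rw [Store.setFlag_setTape, Store.setFlag_setTape, Store.setFlag_setFlag]
    simp [hS4, hS3, cells]
  have h9 : ((S4.setFlag i (meetBits r.2 r'.2)).setTape x (lx, cells r ++ hx)).setTape y
      (ly, cells r' ++ hy) = S.setFlag i (meetBits r.2 r'.2) := by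
    rw [hS4, hS3, hS2, hS1, Store.setFlag_setTape, Store.setFlag_setTape]
    congr 1
    rw [Store.setTape_comm _ hxy (_, hx), Store.setTape_setTape, Store.setTape_comm _ hxy.symm,
      Store.setTape_setTape, Store.setTape_comm _ hxy.symm, Store.setTape_setTape,
      Store.setTape_setTape, S.setTape_eq_self hSx,
      S.setTape_eq_self hSy]
  rw [h8] at h4
  rw [h9] at h7
  exact (h1.seq (h2.seq (h3.seq (h4.seq (h6.seq h7))))).mono (by omega)

end Meets

/-! ### Passes over all hyperedges of a tape -/

/-- Run `c` at each hyperedge of tape `t` in turn and then rewind the tape. -/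
def forRows (t : Tape) (c : Prog) : Prog :=
  .seq (.loop (.hi t) Option.isSome (.seq c (nextRow t))) (rewind t)

section ForRows

variable {ι α : Type*}

/-- The result of a pass over a list that rewrites its items and updates a datum. -/
def pass (upd : ι → α → ι) (step : ι → α → α) : List ι → α → List ι × α
  | [], d => ([], d)
  | i :: is, d => (upd i d :: (pass upd step is (step i d)).1, (pass upd step is (step i d)).2)

theorem pass_eq_foldl (step : ι → α → α) (is : List ι) (d : α) :
    pass (fun i _ => i) step is d = (is, is.foldl (fun d i => step i d) d) := by
  induction is generalizing d with
  | nil => rfl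
  | cons i is ih => simp [pass, ih]

theorem pass_eq_map (upd : ι → α → ι) (is : List ι) (d : α) :
    pass upd (fun _ d => d) is d = (is.map fun i => upd i d, d) := by
  induction is with
  | nil => rfl
  | cons i is ih => simp [pass, ih]

theorem length_behind {n : ℕ} {rs : List (Bool × List Bool)} (h : ∀ r ∈ rs, r.2.length = n) :
    (behind rs).length = rs.length * (n + 1) := by
  induction rs with
  | nil => simp [behind]
  | cons r rs ih =>
    have h1 := ih fun r hr => h r (List.mem_cons_of_mem _ hr)
    have h2 := h r List.mem_cons_self
    simp only [behind, List.flatMap_cons, List.length_append, List.length_cons] at h1 ⊢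
    rw [h1]
    simp [cells, h2]
    ring

theorem reverse_behind (rs : List (Bool × List Bool)) :
    (behind rs).reverse = ahead rs.reverse := by
  induction rs with
  | nil => rfl
  | cons r rs ih =>
    simp only [behind, ahead, List.flatMap_cons, List.reverse_append, List.reverse_reverse,
      List.reverse_cons, List.flatMap_append, List.flatMap_nil, List.append_nil] at ih ⊢
    rw [ih]

variable {t : Tape} {c : Prog} {enc : ι → Bool × List Bool} {n T : ℕ} {rep : α → Store}
  {upd : ι → α → ι} {step : ι → α → α}

/-- Loop invariant: the rows already visited, in updated form, lie to the left of the head, and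
`rep` of the accumulated datum describes everything off tape `t`. -/
theorem exec_forRows_aux (hn : ∀ i, (enc i).2.length = n)
    (hc : ∀ (L : List ι) (i : ι) (R : List ι) (d : α),
      Exec c ((rep d).setTape t (behind (L.map enc), ahead ((i :: R).map enc)))
        ((rep (step i d)).setTape t (behind (L.map enc), ahead ((upd i d :: R).map enc))) T)
    (L is : List ι) (d : α) :
    Exec (.loop (.hi t) Option.isSome (.seq c (nextRow t)))
      ((rep d).setTape t (behind (L.map enc), ahead (is.map enc)))
      ((rep (pass upd step is d).2).setTape t
        (behind (((pass upd step is d).1.reverse ++ L).map enc), []))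
      (is.length * (T + 6 * n + 7) + 1) := by
  induction is generalizing L d with
  | nil => exact (Exec.loop_false (by simp [Store.regs, ahead])).mono (by omega)
  | cons i is ih =>
    have h1 := hc L i is d
    have h2 := exec_nextRow (S := (rep (step i d)).setTape t
      (behind (L.map enc), ahead ((upd i d :: is).map enc))) (t := t)
      (l := behind (L.map enc)) (h := ahead (is.map enc)) (r := enc (upd i d))
      (isBit_head?_ahead _) (by simp [ahead])
    rw [Store.setTape_setTape, hn] at h2
    have h3 := ih (upd i d :: L) (step i d)
    have h4 := Exec.loop_true (p := Option.isSome) (k := .hi t)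
      (by simp [Store.regs, ahead, cells]) (h1.seq h2) h3
    simp only [pass, List.reverse_cons, List.append_assoc, List.cons_append, List.nil_append,
      List.length_cons]
    exact h4.mono (by rw [Nat.succ_mul is.length]; omega)

/-- Per row, the cost beyond `T` is `6 * n + 7` for the loop and `6 * (n + 1)` for rewinding over
the row's cells. -/
theorem exec_forRows (hn : ∀ i, (enc i).2.length = n)
    (hc : ∀ (L : List ι) (i : ι) (R : List ι) (d : α),
      Exec c ((rep d).setTape t (behind (L.map enc), ahead ((i :: R).map enc)))
        ((rep (step i d)).setTape t (behind (L.map enc), ahead ((upd i d :: R).map enc))) T)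
    (is : List ι) (d : α) :
    Exec (forRows t c) ((rep d).setTape t ([], ahead (is.map enc)))
      ((rep (pass upd step is d).2).setTape t ([], ahead ((pass upd step is d).1.map enc)))
      (is.length * (T + 12 * n + 13) + 2) := by
  have hlen : ∀ (is : List ι) d, (pass upd step is d).1.length = is.length := by
    intro is
    induction is with
    | nil => intro d; rfl
    | cons i is ih => intro d; simp [pass, ih]
  have h1 := exec_forRows_aux hn hc [] is d
  have h2 := exec_rewind (S := (rep (pass upd step is d).2).setTape t
        (behind (((pass upd step is d).1.reverse ++ []).map enc), [])) (t := t)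
        (l := behind (((pass upd step is d).1.reverse ++ []).map enc)) (h := []) (by simp)
  rw [length_behind (n := n) (by simp [hn]), Store.setTape_setTape, reverse_behind] at h2
  simp only [List.append_nil, List.map_reverse, List.reverse_reverse, List.length_reverse,
    List.length_map, hlen] at h1 h2
  refine (h1.seq h2).mono (le_of_eq ?_)
  ring

end ForRows

end EdgeElimination

/-! ### Programs for elimination and verdict, with running times -/

namespace EdgeElimination

open StackProg

/-- Compare the current hyperedge of tape `b` with those of the tapes `e` and `f`. -/
def compare : Prog := .seq (meets .b .e .p) (meets .b .f .q)

/-- Raise flag `g` if the current hyperedge of tape `b` is alive, meets the one of tape `f` and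
misses the one of tape `e`. -/
def findBody : Prog :=
  .seq compare <| .seq (.ite (.hi .b) isAlive (ifFlag .p skip (ifFlag .q (raise .g) skip)) skip) <|
    .seq (clear .p) (clear .q)

/-- Discard the current hyperedge of tape `b` if it meets the one of tape `e` and misses the one
of tape `f`. -/
def killBody : Prog :=
  .seq compare <| .seq (ifFlag .p (ifFlag .q skip
    (.seq (.pop (.hi .b)) (.push (.hi .b) (.sep false)))) skip) <| .seq (clear .p) (clear .q)

/-- The elimination step for the current hyperedges of the tapes `e` and `f`. -/
def elimProg : Prog :=
  .seq (forRows .b findBody) <| .seq (ifFlag .g skip (forRows .b killBody)) (clear .g)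

/-- One round of eliminations. -/
def roundProg : Prog := forRows .e (forRows .f elimProg)

/-- Raise flag `g` if the current hyperedge of tape `b` is alive and meets the one of tape `e`. -/
def hitBody : Prog :=
  .seq (meets .b .e .p) <| .seq (ifFlag .p (.ite (.hi .b) isAlive (raise .g) skip) skip) (clear .p)

/-- Output the verdict. -/
def verdictProg : Prog :=
  .ite (.hi .e) Option.isNone (.push .out true) <| .seq (forRows .e (forRows .b hitBody)) <|
    .seq (ifFlag .g (.push .out true) (.push .out false)) (clear .g)

/-- Empty the right part of tape `t`. -/
def erase (t : Tape) : Prog := .loop (.hi t) Option.isSome (.pop (.hi t))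

/-- Push a symbol onto the right parts of all tapes. -/
def pushAll (c : Cell) : Prog :=
  .seq (.push (.hi .e) c) <| .seq (.push (.hi .f) c) (.push (.hi .b) c)

/-- Process the current symbol of the list of rows of the incidence matrix. -/
def readBody : Prog :=
  .seq (.push .ctr ()) <| .seq (.ite .inp (fun x => x == some none) (pushAll (.sep true))
    (.ite .inp (fun x => x == some (some true)) (pushAll (.bit true)) (pushAll (.bit false))))
    (.pop .inp)

/-- Read the input. -/
def readProg : Prog :=
  .seq (.loop .inp (fun x => x == some (some true)) (.pop .inp)) <| .seq (.pop .inp) <|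
    .loop .inp Option.isSome readBody

/-- The program that decides whether an α-acyclic hypergraph has an efficient edge dominating
set. -/
def mainProg : Prog :=
  .seq readProg <| .seq (.loop .ctr Option.isSome (.seq (.pop .ctr) roundProg)) <|
    .seq verdictProg <| .seq (erase .e) <| .seq (erase .f) (erase .b)

section Passes

variable {S : Store} {n : ℕ} {re rf rb : Bool × List Bool} {le he lf hf lb hb : List Cell}

theorem exec_compare (hre : re.2.length = n) (hrf : rf.2.length = n) (hrb : rb.2.length = n)
    (hhb : isBit hb.head? = false) (hSe : S.tape .e = (le, cells re ++ he))
    (hSf : S.tape .f = (lf, cells rf ++ hf)) (hSb : S.tape .b = (lb, cells rb ++ hb)) :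
    Exec compare S ((S.setFlag .p (meetBits rb.2 re.2)).setFlag .q (meetBits rb.2 rf.2))
      (56 * n + 48) := by
  have h1 := exec_meets (i := .p) (x := .b) (y := .e) (by decide) (hrb.trans hre.symm) hhb hSb hSe
  have h2 := exec_meets (S := S.setFlag .p (meetBits rb.2 re.2)) (i := .q) (x := .b) (y := .f)
    (by decide) (hrb.trans hrf.symm) hhb hSb hSf
  exact (h1.seq h2).mono (by omega)

theorem exec_findBody (hre : re.2.length = n) (hrf : rf.2.length = n) (hrb : rb.2.length = n)
    (hhb : isBit hb.head? = false) (hSe : S.tape .e = (le, cells re ++ he))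
    (hSf : S.tape .f = (lf, cells rf ++ hf)) (hSb : S.tape .b = (lb, cells rb ++ hb))
    (hp : S.flag .p = false) (hq : S.flag .q = false) :
    Exec findBody S (S.setFlag .g (S.flag .g ||
      (rb.1 && (meetBits rb.2 rf.2 && !meetBits rb.2 re.2)))) (56 * n + 56) := by
  have h1 := exec_compare hre hrf hrb hhb hSe hSf hSb
  set v := meetBits rb.2 re.2
  set w := meetBits rb.2 rf.2
  set S1 := (S.setFlag .p v).setFlag .q w with hS1
  have hfp : S1.flag .p = v := by simp [hS1]
  have hfq : S1.flag .q = w := by simp [hS1]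
  have hfg : S1.flag .g = S.flag .g := by simp [hS1]
  have hb1 : (S1.regs (.hi .b)).head? = some (.sep rb.1) := by
    simp [Store.regs, hS1, hSb, cells]
  have h2 : Exec (.ite (.hi .b) isAlive (ifFlag .p skip (ifFlag .q (raise .g) skip)) skip) S1
      (S1.setFlag .g (S.flag .g || (rb.1 && (w && !v)))) 6 := by
    cases ha : rb.1 with
    | false =>
      rw [S1.setFlag_eq_self (by simp [hfg])]
      exact (Exec.ite_false (by rw [hb1, ha]; rfl) exec_skip).mono (by norm_num)
    | true =>
      refine (Exec.ite_true (T := 5) (by rw [hb1, ha]; rfl) (exec_ifFlag ?_))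
      rw [hfp]
      cases v with
      | true =>
        rw [S1.setFlag_eq_self (by simp [hfg])]
        exact exec_skip.mono (by norm_num)
      | false =>
        refine exec_ifFlag ?_
        rw [hfq]
        cases w with
        | true => simpa using exec_raise (S := S1) .g
        | false =>
          rw [S1.setFlag_eq_self (by simp [hfg])]
          exact exec_skip.mono (by norm_num)
  have h3 := (h1.seq (h2.seq ((exec_clear .p).seq (exec_clear .q))))
  -- The two auxiliary flags were down at the start, so lowering them restores the store up to flag
  -- `g`.
  have h4 : ((S1.setFlag .g (S.flag .g || (rb.1 && (w && !v)))).setFlag .p false).setFlag .q false =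
      S.setFlag .g (S.flag .g || (rb.1 && (w && !v))) := by
    ext1 <;> try rfl
    funext i
    cases i <;> simp [hS1, hp, hq]
  rw [h4] at h3
  exact h3.mono (by omega)

/-- Aliveness need not be read: overwriting the separator of a dead row by a dead one is harmless.
The bound is padded to match that of `findBody`. -/
theorem exec_killBody (hre : re.2.length = n) (hrf : rf.2.length = n) (hrb : rb.2.length = n)
    (hhb : isBit hb.head? = false) (hSe : S.tape .e = (le, cells re ++ he))
    (hSf : S.tape .f = (lf, cells rf ++ hf)) (hSb : S.tape .b = (lb, cells rb ++ hb))
    (hp : S.flag .p = false) (hq : S.flag .q = false) :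
    Exec killBody S (S.setTape .b (lb, cells (rb.1 && !(meetBits rb.2 re.2 && !meetBits rb.2 rf.2),
      rb.2) ++ hb)) (56 * n + 56) := by
  have h1 := exec_compare hre hrf hrb hhb hSe hSf hSb
  set v := meetBits rb.2 re.2
  set w := meetBits rb.2 rf.2
  set S1 := (S.setFlag .p v).setFlag .q w with hS1
  have hfp : S1.flag .p = v := by simp [hS1]
  have hfq : S1.flag .q = w := by simp [hS1]
  have hb1 : S1.tape .b = (lb, cells rb ++ hb) := hSb
  have h2 : Exec (ifFlag .p (ifFlag .q skip
    (.seq (.pop (.hi .b)) (.push (.hi .b) (.sep false)))) skip) S1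
      (S1.setTape .b (lb, cells (rb.1 && !(v && !w), rb.2) ++ hb)) 4 := by
    refine exec_ifFlag ?_
    rw [hfp]
    cases v with
    | false =>
      rw [S1.setTape_eq_self (by simpa using hb1)]
      exact exec_skip.mono (by norm_num)
    | true =>
      refine exec_ifFlag ?_
      rw [hfq]
      cases w with
      | true =>
        rw [S1.setTape_eq_self (by simpa using hb1)]
        exact exec_skip.mono (by norm_num)
      | false =>
        have h := (exec_pop_hi (S := S1) .b).seq (exec_push_hi .b (.sep false))
        simpa [hb1, cells] using h
  have h3 := (h1.seq (h2.seq ((exec_clear .p).seq (exec_clear .q))))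
  have h4 : ((S1.setTape .b (lb, cells (rb.1 && !(v && !w), rb.2) ++ hb)).setFlag .p
      false).setFlag .q false =
      S.setTape .b (lb, cells (rb.1 && !(v && !w), rb.2) ++ hb) := by
    ext1 <;> try rfl
    funext i
    cases i <;> simp [hS1, hp, hq]
  rw [h4] at h3
  exact h3.mono (by omega)

theorem exec_hitBody (hre : re.2.length = n) (hrb : rb.2.length = n)
    (hhb : isBit hb.head? = false) (hSe : S.tape .e = (le, cells re ++ he))
    (hSb : S.tape .b = (lb, cells rb ++ hb)) (hp : S.flag .p = false) :
    Exec hitBody S (S.setFlag .g (S.flag .g || (rb.1 && meetBits rb.2 re.2))) (28 * n + 30) := by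
  have h1 := exec_meets (i := .p) (x := .b) (y := .e) (by decide) (hrb.trans hre.symm) hhb hSb hSe
  set v := meetBits rb.2 re.2
  set S1 := S.setFlag .p v with hS1
  have hfp : S1.flag .p = v := by simp [hS1]
  have hfg : S1.flag .g = S.flag .g := by simp [hS1]
  have hb1 : (S1.regs (.hi .b)).head? = some (.sep rb.1) := by
    simp [Store.regs, hS1, hSb, cells]
  have h2 : Exec (ifFlag .p (.ite (.hi .b) isAlive (raise .g) skip) skip) S1
      (S1.setFlag .g (S.flag .g || (rb.1 && v))) 5 := by
    refine exec_ifFlag ?_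
    rw [hfp]
    cases v with
    | false =>
      rw [S1.setFlag_eq_self (by simp [hfg])]
      exact exec_skip.mono (by norm_num)
    | true =>
      cases ha : rb.1 with
      | false =>
        rw [S1.setFlag_eq_self (by simp [hfg])]
        exact (Exec.ite_false (by rw [hb1, ha]; rfl) exec_skip).mono (by norm_num)
      | true =>
        refine (Exec.ite_true (T := 3) (by rw [hb1, ha]; rfl) ?_)
        simpa using exec_raise (S := S1) .g
  have h3 := (h1.seq (h2.seq (exec_clear .p)))
  have h4 : (S1.setFlag .g (S.flag .g || (rb.1 && v))).setFlag .p false =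
      S.setFlag .g (S.flag .g || (rb.1 && v)) := by
    ext1 <;> try rfl
    funext i
    cases i <;> simp [hS1, hp]
  rw [h4] at h3
  exact h3.mono (by omega)

end Passes

section Rounds

variable {ι : Type} (bits : ι → List Bool) (es : List ι)

/-- The word for all hyperedges, of which those in `A` are alive. -/
def allRows (A : ι → Bool) : List Cell := ahead (es.map fun i => (A i, bits i))

/-- The store between the phases of the algorithm. -/
def mainStore (A : ι → Bool) (g : Bool) (c : List Unit) : Store where
  inp := []
  out := []
  ctr := c
  tape
    | .b => ([], allRows bits es A)
    | _ => ([], allRows bits es fun _ => true)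
  flag
    | .g => g
    | _ => false

/-- The hyperedges intersect, according to their incidence bits. -/
def meetRel (i j : ι) : Bool := meetBits (bits i) (bits j)

variable {bits es} {n : ℕ} (hn : ∀ i, (bits i).length = n)

theorem allRows_eq (A : ι → Bool) : allRows bits es A =
    ahead ((es.map fun i => (A i, i)).map fun x : Bool × ι => (x.1, bits x.2)) := by
  simp [allRows, Function.comp_def]

include hn in
-- The first pass accumulates in flag `g` whether some candidate blocks the elimination; only then
-- does the second pass discard anything, so the test refers to the unmodified `A`, as in `elim`.
-- Here `68 * n + 69` is the body bound `56 * n + 56` plus the pass overhead `12 * n + 13`.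
theorem exec_elimProg {S : Store} {A : ι → Bool} {e f : ι} {be bf : Bool} {le he lf hf : List Cell}
    (hSe : S.tape .e = (le, cells (be, bits e) ++ he))
    (hSf : S.tape .f = (lf, cells (bf, bits f) ++ hf)) (hSb : S.tape .b = ([], allRows bits es A))
    (hflag : ∀ i, S.flag i = false) :
    Exec elimProg S (S.setTape .b ([], allRows bits es (elim (meetRel bits) es A e f)))
      (2 * (es.length * (68 * n + 69) + 2) + 2) := by
  set r := meetRel bits
  have h1 := exec_forRows (t := .b) (c := findBody) (n := n)
    (enc := fun x : Bool × ι => (x.1, bits x.2))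
    (T := 56 * n + 56) (rep := fun g => S.setFlag .g g) (upd := fun x _ => x)
    (step := fun x g => g || (x.1 && (r x.2 f && !r x.2 e))) (fun x => hn x.2)
    (fun L x R g => by
      have h := exec_findBody (S := (S.setFlag .g g).setTape .b
        (behind (L.map fun x => (x.1, bits x.2)), ahead ((x :: R).map fun x => (x.1, bits x.2))))
        (n := n) (re := (be, bits e)) (rf := (bf, bits f)) (rb := (x.1, bits x.2))
        (hb := ahead (R.map fun x => (x.1, bits x.2))) (le := le) (he := he) (lf := lf) (hf := hf)
        (lb := behind (L.map fun x => (x.1, bits x.2)))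
        (hn _) (hn _) (hn _) (isBit_head?_ahead _) (by simpa using hSe) (by simpa using hSf)
        (by simp [ahead]) (by simp [hflag]) (by simp [hflag])
      simpa [← Store.setFlag_setTape, r, meetRel] using h)
    (es.map fun i => (A i, i)) false
  rw [pass_eq_foldl] at h1
  simp only [← allRows_eq, List.length_map] at h1
  have hfold : ∀ (l : List ι) (g : Bool),
      (l.map fun i => (A i, i)).foldl (fun g x => g || (x.1 && (r x.2 f && !r x.2 e))) g =
      (g || l.any fun b => A b && (r b f && !r b e)) := by
    intro l
    induction l with
    | nil => simp
    | cons b l ih => intro g; simp [ih, Bool.or_assoc]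
  have hS0 : S.setFlag .g false = S := S.setFlag_eq_self (hflag _)
  rw [hfold, Bool.false_or, hS0, S.setTape_eq_self hSb, Store.setFlag_setTape,
    S.setTape_eq_self hSb] at h1
  set v := es.any fun b => A b && (r b f && !r b e)
  have h2 := exec_forRows (t := .b) (c := killBody) (n := n)
    (enc := fun x : Bool × ι => (x.1, bits x.2))
    (T := 56 * n + 56) (rep := fun _ : Unit => S)
    (upd := fun x _ => (x.1 && !(r x.2 e && !r x.2 f), x.2))
    (step := fun x g => g) (fun x => hn x.2)
    (fun L x R g => by
      have h := exec_killBody (S := S.setTape .b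
        (behind (L.map fun x => (x.1, bits x.2)), ahead ((x :: R).map fun x => (x.1, bits x.2))))
        (n := n) (re := (be, bits e)) (rf := (bf, bits f)) (rb := (x.1, bits x.2))
        (hb := ahead (R.map fun x => (x.1, bits x.2))) (le := le) (he := he) (lf := lf) (hf := hf)
        (lb := behind (L.map fun x => (x.1, bits x.2)))
        (hn _) (hn _) (hn _) (isBit_head?_ahead _) (by simpa using hSe) (by simpa using hSf)
        (by simp [ahead]) (by simp [hflag]) (by simp [hflag])
      rw [Store.setTape_setTape] at h
      exact h)
    (es.map fun i => (A i, i)) ()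
  rw [pass_eq_map] at h2
  rw [← allRows_eq, List.length_map, S.setTape_eq_self hSb] at h2
  have h3 : Exec (ifFlag .g skip (forRows .b killBody)) (S.setFlag .g v)
      ((S.setTape .b ([], allRows bits es (elim r es A e f))).setFlag .g v)
      (es.length * (56 * n + 56 + 12 * n + 13) + 2 + 1) := by
    refine exec_ifFlag ?_
    unfold elim
    change Exec _ _ ((S.setTape .b ([], allRows bits es (if v = true then _ else _))).setFlag .g v) _
    cases v with
    | true =>
      simp only [Store.setFlag_flag, Function.update_self, if_true]
      rw [S.setTape_eq_self hSb]
      exact exec_skip.mono (by omega)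
    | false =>
      simp only [Store.setFlag_flag, Function.update_self, Bool.false_eq_true, if_false]
      rw [hS0, Store.setFlag_eq_self (i := .g) _ (by simp [hflag])]
      simpa [allRows, Function.comp_def] using h2
  have h4 := h1.seq (h3.seq (exec_clear .g))
  rw [Store.setFlag_setFlag, Store.setFlag_eq_self (i := .g) _ (by simp [hflag])] at h4
  exact h4.mono (by ring_nf; omega)

/-- Aliveness is recorded on tape `b` only, so a new set `A'` can be absorbed into the main store
while the other two heads are in mid-tape. -/
theorem mainStore_setTape_b {A A' : ι → Bool} {g : Bool} {c : List Unit} {x y} :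
    (((mainStore bits es A g c).setTape .e x).setTape .f y).setTape .b ([], allRows bits es A') =
      ((mainStore bits es A' g c).setTape .e x).setTape .f y := by
  ext1 <;> try rfl
  funext t
  cases t <;> simp [mainStore]

include hn in
theorem exec_roundProg (A : ι → Bool) (c : List Unit) :
    Exec roundProg (mainStore bits es A false c)
      (mainStore bits es (round (meetRel bits) es A) false c)
      (es.length * (es.length * (2 * (es.length * (68 * n + 69) + 2) + 2 + 12 * n + 13) + 2 +
        12 * n + 13) + 2) := by
  set enc : ι → Bool × List Bool := fun i => (true, bits i) with henc
  have hall : (allRows bits es fun _ => true) = ahead (es.map enc) := rfl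
  have h := exec_forRows (t := .e) (c := forRows .f elimProg) (n := n) (enc := enc)
    (T := es.length * (2 * (es.length * (68 * n + 69) + 2) + 2 + 12 * n + 13) + 2)
    (rep := fun A => mainStore bits es A false c) (upd := fun i _ => i)
    (step := fun e A => es.foldl (fun A f => elim (meetRel bits) es A e f) A) hn
    (fun L e R A => by
      have h := exec_forRows (t := .f) (c := elimProg) (n := n) (enc := enc)
        (T := 2 * (es.length * (68 * n + 69) + 2) + 2)
        (rep := fun A => (mainStore bits es A false c).setTape .e
          (behind (L.map enc), ahead ((e :: R).map enc))) (upd := fun i _ => i)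
        (step := fun f A => elim (meetRel bits) es A e f) hn
        (fun L' f R' A => by
          have h := exec_elimProg hn (es := es) (S := ((mainStore bits es A false c).setTape .e
            (behind (L.map enc), ahead ((e :: R).map enc))).setTape .f
            (behind (L'.map enc), ahead ((f :: R').map enc))) (A := A) (e := e) (f := f)
            (be := true) (bf := true) (he := ahead (R.map enc)) (hf := ahead (R'.map enc))
            (le := behind (L.map enc)) (lf := behind (L'.map enc))
            (by simp [ahead, henc]) (by simp [ahead, henc]) (by simp [mainStore])
            (fun i => by cases i <;> rfl)
          rw [mainStore_setTape_b] at h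
          exact h) es A
      rw [pass_eq_foldl] at h
      rw [Store.setTape_eq_self (t := .f) _ (by simp [mainStore, hall]),
        Store.setTape_eq_self (t := .f) _ (by simp [mainStore, hall])] at h
      exact h) es A
  rw [pass_eq_foldl] at h
  rw [Store.setTape_eq_self (t := .e) _ (by simp [mainStore, hall]),
    Store.setTape_eq_self (t := .e) _ (by simp [mainStore, hall])] at h
  exact h

include hn in
-- The counter is consumed one token per round, so its length is the number of iterations.
theorem exec_rounds (A : ι → Bool) (c : List Unit) :
    Exec (.loop .ctr Option.isSome (.seq (.pop .ctr) roundProg)) (mainStore bits es A false c)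
      (mainStore bits es ((round (meetRel bits) es)^[c.length] A) false [])
      (c.length * (es.length * (es.length * (2 * (es.length * (68 * n + 69) + 2) + 2 + 12 * n + 13)
        + 2 + 12 * n + 13) + 4) + 1) := by
  induction c generalizing A with
  | nil => exact (Exec.loop_false (by simp [Store.regs, mainStore])).mono (by simp)
  | cons u c ih =>
    have h1 : Exec (.pop .ctr) (mainStore bits es A false (u :: c)) (mainStore bits es A false c) 1 :=
      exec_pop_ctr
    have h2 := Exec.loop_true (p := Option.isSome) (k := .ctr)
      (by simp [Store.regs, mainStore]) (h1.seq (exec_roundProg hn A c)) (ih _)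
    rw [List.length_cons, Function.iterate_succ_apply]
    exact h2.mono (by rw [Nat.succ_mul c.length]; omega)

include hn in
theorem exec_verdictProg (A : ι → Bool) :
    Exec verdictProg (mainStore bits es A false [])
      { mainStore bits es A false [] with out := [verdict (meetRel bits) es A] }
      (es.length * (es.length * (40 * n + 43) + 2 + 12 * n + 13) + 6) := by
  have hrw : verdict (meetRel bits) es A =
    (es.isEmpty || es.any fun e => es.any fun b => A b && meetRel bits b e) := rfl
  by_cases hes : es = []
  · subst hes
    exact (Exec.ite_true (by simp [Store.regs, mainStore, allRows, ahead])
      (exec_push_out true)).mono (by omega)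
  set enc : ι → Bool × List Bool := fun i => (true, bits i) with henc
  have hall : (allRows bits es fun _ => true) = ahead (es.map enc) := rfl
  have h := exec_forRows (t := .e) (c := forRows .b hitBody) (n := n) (enc := enc)
    (T := es.length * (40 * n + 43) + 2)
    (rep := fun g => mainStore bits es A g []) (upd := fun i _ => i)
    (step := fun e g => g || es.any fun b => A b && meetRel bits b e) hn
    (fun L e R g => by
      have h := exec_forRows (t := .b) (c := hitBody) (n := n)
        (enc := fun x : Bool × ι => (x.1, bits x.2)) (T := 28 * n + 30)
        (rep := fun g => (mainStore bits es A g []).setTape .e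
          (behind (L.map enc), ahead ((e :: R).map enc))) (upd := fun i _ => i)
        (step := fun x g => g || (x.1 && meetRel bits x.2 e)) (fun x => hn x.2)
        (fun L' x R' g => by
          have h := exec_hitBody (S := ((mainStore bits es A g []).setTape .e
            (behind (L.map enc), ahead ((e :: R).map enc))).setTape .b
            (behind (L'.map fun x => (x.1, bits x.2)), ahead ((x :: R').map fun x => (x.1, bits x.2))))
            (re := (true, bits e)) (rb := (x.1, bits x.2)) (he := ahead (R.map enc))
            (le := behind (L.map enc)) (hb := ahead (R'.map fun x => (x.1, bits x.2)))
            (lb := behind (L'.map fun x => (x.1, bits x.2))) (hn _) (hn _)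
            (isBit_head?_ahead _) (by simp [ahead, henc]) (by simp [ahead]) rfl
          convert h using 1
          ext1 <;> try rfl
          funext i
          cases i <;> simp [mainStore, meetRel])
        (es.map fun i => (A i, i)) g
      have hfold : ∀ (l : List ι) (g : Bool),
          (l.map fun i => (A i, i)).foldl (fun g x => g || (x.1 && meetRel bits x.2 e)) g =
          (g || l.any fun b => A b && meetRel bits b e) := by
        intro l
        induction l with
        | nil => simp
        | cons b l ih => intro g; simp [ih, Bool.or_assoc]
      rw [pass_eq_foldl] at h
      simp only [← allRows_eq, List.length_map, hfold] at h
      rw [Store.setTape_eq_self (t := .b) _ (by simp [mainStore]),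
        Store.setTape_eq_self (t := .b) _ (by simp [mainStore])] at h
      exact h.mono (by ring_nf; omega)) es false
  have hfold : ∀ (l : List ι) (g : Bool),
      l.foldl (fun g e => g || es.any fun b => A b && meetRel bits b e) g =
      (g || l.any fun e => es.any fun b => A b && meetRel bits b e) := by
    intro l
    induction l with
    | nil => simp
    | cons b l ih => intro g; simp [ih, Bool.or_assoc]
  rw [pass_eq_foldl] at h
  simp only [hfold, Bool.false_or] at h
  rw [Store.setTape_eq_self (t := .e) _ (by simp [mainStore, hall]),
    Store.setTape_eq_self (t := .e) _ (by simp [mainStore, hall])] at h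
  have hv : (es.any fun e => es.any fun b => A b && meetRel bits b e) =
      verdict (meetRel bits) es A := by
    rw [hrw, List.isEmpty_eq_false_iff.mpr hes, Bool.false_or]
  rw [hv] at h
  set v := verdict (meetRel bits) es A
  have h1 : Exec (ifFlag .g (.push .out true) (.push .out false)) (mainStore bits es A v [])
      { mainStore bits es A v [] with out := [v] } 2 := by
    refine exec_ifFlag ?_
    change Exec (if v = true then _ else _) _ _ _
    cases v
    · exact exec_push_out _
    · exact exec_push_out _
  have h2 := h.seq (h1.seq (exec_clear .g))
  have h3 : ({ mainStore bits es A v [] with out := [v] } : Store).setFlag .g false =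
      { mainStore bits es A false [] with out := [v] } := by
    ext1 <;> try rfl
    funext i
    cases i <;> simp [mainStore]
  rw [h3] at h2
  -- A nonempty list puts a separator on top of the stack, so the initial emptiness test fails.
  obtain ⟨e, es', hes'⟩ := List.exists_cons_of_ne_nil hes
  refine (Exec.ite_false ?_ h2).mono (by omega)
  simp [Store.regs, mainStore, allRows, ahead, hes', cells]

end Rounds

/-! ### Erasing tapes and reading the input -/

theorem exec_erase {S : Store} {t : Tape} {l h : List Cell} (hS : S.tape t = (l, h)) :
    Exec (erase t) S (S.setTape t (l, [])) (2 * h.length + 1) := by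
  induction h generalizing S with
  | nil =>
    rw [S.setTape_eq_self hS]
    exact Exec.loop_false (by simp [Store.regs, hS])
  | cons c h ih =>
    have h1 := exec_pop_hi (S := S) t
    have h2 := ih (S := S.setTape t ((S.tape t).1, (S.tape t).2.tail)) (by simp [hS])
    rw [Store.setTape_setTape] at h2
    exact (Exec.loop_true (by simp [Store.regs, hS]) h1 h2).mono (by rw [List.length_cons]; omega)

/-- The store while the input is being read. -/
def readStore (w : List (Option Bool)) (c : List Unit) (X : List Cell) : Store where
  inp := w
  out := []
  ctr := c
  tape := fun _ => ([], X)
  flag := fun _ => false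

/-- The translation of input symbols to tape symbols. -/
def toCell : Option Bool → Cell
  | none => .sep true
  | some b => .bit b

theorem exec_pushAll (a : Cell) (w : List (Option Bool)) (c : List Unit) (X : List Cell) :
    Exec (pushAll a) (readStore w c X) (readStore w c (a :: X)) 3 := by
  have h : Exec (pushAll a) _ _ 3 := (exec_push_hi (S := readStore w c X) .e a).seq
    ((exec_push_hi .f a).seq (exec_push_hi .b a))
  convert h using 1
  ext1 <;> try rfl
  funext t
  cases t <;> simp [readStore]

theorem exec_readBody (a : Option Bool) (w : List (Option Bool)) (c : List Unit) (X : List Cell) :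
    Exec readBody (readStore (a :: w) c X) (readStore w (() :: c) (toCell a :: X)) 7 := by
  have h1 : Exec (.push .ctr ()) (readStore (a :: w) c X) (readStore (a :: w) (() :: c) X) 1 :=
    exec_push_ctr
  have h3 : Exec (.pop .inp) (readStore (a :: w) (() :: c) (toCell a :: X))
      (readStore w (() :: c) (toCell a :: X)) 1 := exec_pop_inp
  refine Exec.mono (h1.seq (Exec.seq (T := 5) ?_ h3)) (by norm_num)
  rcases a with _ | _ | _
  · exact (Exec.ite_true rfl (exec_pushAll _ _ _ _)).mono (by norm_num)
  · exact Exec.ite_false rfl (.ite_false rfl (exec_pushAll _ _ _ _))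
  · exact Exec.ite_false rfl (.ite_true rfl (exec_pushAll _ _ _ _))

/-- Pushing reverses the word, so the mark that ended a row in the input now precedes its bits on
the tape. One counter token per symbol read provides the number of rounds without any arithmetic. -/
theorem exec_readLoop (w : List (Option Bool)) (c : List Unit) (X : List Cell) :
    Exec (.loop .inp Option.isSome readBody) (readStore w c X)
      (readStore [] (List.replicate w.length () ++ c) ((w.map toCell).reverse ++ X))
      (8 * w.length + 1) := by
  induction w generalizing c X with
  | nil => exact Exec.loop_false rfl
  | cons a w ih =>
    have h := Exec.loop_true (p := Option.isSome) (k := .inp) rfl (exec_readBody a w c X) (ih _ _)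
    have h1 : List.replicate (a :: w).length () ++ c = List.replicate w.length () ++ () :: c := by
      rw [List.length_cons, List.replicate_succ', List.append_assoc, List.singleton_append]
    rw [h1]
    simp only [List.map_cons, List.reverse_cons, List.append_assoc, List.singleton_append,
      List.length_cons]
    exact h.mono (by omega)

theorem exec_readProg (n : ℕ) (w : List (Option Bool)) :
    Exec readProg (readStore (List.replicate n (some true) ++ none :: w) [] [])
      (readStore [] (List.replicate w.length ()) (w.map toCell).reverse)
      (2 * n + 8 * w.length + 3) := by
  have h1 : ∀ n, Exec (.loop .inp (fun x => x == some (some true)) (.pop .inp))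
      (readStore (List.replicate n (some true) ++ none :: w) [] []) (readStore (none :: w) [] [])
      (2 * n + 1) := by
    intro n
    induction n with
    | zero => exact Exec.loop_false rfl
    | succ n ih =>
      have h : Exec (.pop .inp)
          (readStore (List.replicate (n + 1) (some true) ++ none :: w) [] [])
          (readStore (List.replicate n (some true) ++ none :: w) [] []) 1 := exec_pop_inp
      exact (Exec.loop_true rfl h ih).mono (by omega)
  have h2 : Exec (.pop .inp) (readStore (none :: w) [] []) (readStore w [] []) 1 := exec_pop_inp
  have h3 := (h1 n).seq (h2.seq (exec_readLoop w [] []))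
  simp only [List.append_nil] at h3
  exact h3.mono (by omega)

end EdgeElimination

/-! ### From the encoded input to the tapes, and the polynomial bound -/

namespace EdgeElimination

open StackProg

theorem meetBits_ofFn {n : ℕ} (f g : Fin n → Bool) :
    meetBits (List.ofFn f) (List.ofFn g) = true ↔ ∃ v, f v = true ∧ g v = true := by
  induction n with
  | zero => simp [meetBits]
  | succ n ih => simp [List.ofFn_succ, meetBits, ih, Fin.exists_fin_succ]

/-- The incidence bits of a set of vertices in the order in which they occur on a tape. -/
def rowBits {n : ℕ} (s : Finset (Fin n)) : List Bool := List.ofFn fun v => decide (v.rev ∈ s)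

theorem length_rowBits {n : ℕ} (s : Finset (Fin n)) : (rowBits s).length = n := by simp [rowBits]

theorem reverse_map_rowCode {n : ℕ} (s : Finset (Fin n)) :
    ((HypergraphInstance.rowCode s).map toCell).reverse = (rowBits s).map Cell.bit := by
  apply List.ext_getElem
  · simp [HypergraphInstance.rowCode, rowBits]
  · intro i h1 h2
    simp only [HypergraphInstance.rowCode, rowBits, List.getElem_reverse, List.getElem_map,
      List.getElem_ofFn, toCell, List.length_map, List.length_ofFn]
    congr 4
    rw [Nat.sub_sub, Nat.add_comm 1]

theorem meetBits_rowBits {n : ℕ} (s t : Finset (Fin n)) :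
    meetBits (rowBits s) (rowBits t) = true ↔ ∃ v, v ∈ s ∧ v ∈ t := by
  rw [rowBits, rowBits, meetBits_ofFn]
  simp only [decide_eq_true_eq]
  exact ⟨fun ⟨v, h⟩ => ⟨v.rev, h⟩, fun ⟨v, h⟩ => ⟨v.rev, by simpa using h⟩⟩

theorem reverse_map_rows {n : ℕ} {ι : Type} (edge : ι → Finset (Fin n)) (l : List ι) :
    (((l.map fun e => HypergraphInstance.rowCode (edge e) ++ [none]).flatten).map toCell).reverse =
      ahead (l.reverse.map fun i => (true, rowBits (edge i))) := by
  induction l with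
  | nil => rfl
  | cons e l ih =>
    rw [List.map_cons, List.flatten_cons, List.map_append, List.reverse_append, ih,
      List.map_append, List.reverse_append, reverse_map_rowCode]
    simp [ahead, cells, toCell]

theorem length_rows {n : ℕ} {ι : Type} (edge : ι → Finset (Fin n)) (l : List ι) :
    ((l.map fun e => HypergraphInstance.rowCode (edge e) ++ [none]).flatten).length =
      l.length * (n + 1) := by
  induction l with
  | nil => simp
  | cons e l ih =>
    rw [List.map_cons, List.flatten_cons, List.length_append, ih]
    simp [HypergraphInstance.rowCode]
    ring

theorem length_allRows {ι : Type} {bits : ι → List Bool} {n : ℕ} (hn : ∀ i, (bits i).length = n)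
    (es : List ι) (A : ι → Bool) : (allRows bits es A).length = es.length * (n + 1) := by
  induction es with
  | nil => simp [allRows, ahead]
  | cons e es ih =>
    simp only [allRows, ahead, List.map_cons, List.flatMap_cons, List.length_append,
      List.length_cons] at ih ⊢
    rw [ih]
    simp [cells, hn]
    ring

/-- A bound on the running time in terms of the length of the input. -/
def timeBound (N : ℕ) : ℕ :=
  (2 * N + 8 * N + 3) + ((N * (N * (N * (2 * (N * (68 * N + 69) + 2) + 2 + 12 * N + 13)
        + 2 + 12 * N + 13) + 4) + 1) + ((N * (N * (40 * N + 43) + 2 + 12 * N + 13) + 6) +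
    ((2 * N + 1) + ((2 * N + 1) + (2 * N + 1)))))

/-- The final erasures are needed because a halting configuration may have nothing but the output on
its stacks. -/
theorem exec_mainProg {ι : Type} {n : ℕ} (edge : ι → Finset (Fin n)) (l : List ι) {N : ℕ}
    (hN : N = n + 1 + l.length * (n + 1)) :
    Exec mainProg (readStore (List.replicate n (some true) ++ none ::
        (l.map fun e => HypergraphInstance.rowCode (edge e) ++ [none]).flatten) [] [])
      { readStore [] [] [] with out := [verdict (meetRel fun i => rowBits (edge i)) l.reverse
        ((round (meetRel fun i => rowBits (edge i)) l.reverse)^[l.length * (n + 1)]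
          fun _ => true)] }
      (timeBound N) := by
  set w := (l.map fun e => HypergraphInstance.rowCode (edge e) ++ [none]).flatten with hw
  set bits : ι → List Bool := fun i => rowBits (edge i)
  have hn : ∀ i, (bits i).length = n := fun i => length_rowBits _
  have hwl : w.length = l.length * (n + 1) := length_rows edge l
  have h1 := exec_readProg n w
  have hstore : readStore [] (List.replicate w.length ()) (w.map toCell).reverse =
      mainStore bits l.reverse (fun _ => true) false (List.replicate w.length ()) := by
    rw [hw, reverse_map_rows]
    ext1 <;> try rfl
    · funext t
      cases t <;> rfl
    · funext i
      cases i <;> rfl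
  rw [hstore] at h1
  have h2 := exec_rounds hn (es := l.reverse) (fun _ => true) (List.replicate w.length ())
  rw [List.length_replicate, hwl] at h2
  rw [hwl] at h1
  set A := (round (meetRel bits) l.reverse)^[l.length * (n + 1)] fun _ => true
  have h3 := exec_verdictProg hn (es := l.reverse) A
  set S := { mainStore bits l.reverse A false [] with
    out := [verdict (meetRel bits) l.reverse A] } with hS
  have h4 := exec_erase (S := S) (t := .e) (l := []) (h := allRows bits l.reverse fun _ => true) rfl
  have h5 := exec_erase (S := S.setTape .e ([], [])) (t := .f) (l := [])
    (h := allRows bits l.reverse fun _ => true) rfl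
  have h6 := exec_erase (S := (S.setTape .e ([], [])).setTape .f ([], [])) (t := .b) (l := [])
    (h := allRows bits l.reverse A) rfl
  rw [length_allRows hn] at h4 h5 h6
  have h7 := h1.seq (h2.seq (h3.seq (h4.seq (h5.seq h6))))
  have hend : ((S.setTape .e ([], [])).setTape .f ([], [])).setTape .b ([], []) =
      { readStore [] [] [] with out := [verdict (meetRel bits) l.reverse A] } := by
    ext1 <;> try rfl
    · funext t
      cases t <;> simp [readStore]
    · funext i
      cases i <;> rfl
  rw [hend, List.length_reverse] at h7
  refine h7.mono ?_
  -- The row length, the number of rows and the number of rounds are all at most the input length,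
  -- and the bound is monotone in each.
  have e1 : n ≤ N := by omega
  have e2 : l.length * (n + 1) ≤ N := by omega
  have e3 : l.length ≤ N := (Nat.le_mul_of_pos_right _ n.succ_pos).trans e2
  unfold timeBound
  gcongr

/-- The polynomial whose values are given by `timeBound`. -/
noncomputable def timePoly : Polynomial ℕ :=
  (2 * .X + 8 * .X + 3) + ((.X * (.X * (.X * (2 * (.X * (68 * .X + 69) + 2) + 2 + 12 * .X + 13)
        + 2 + 12 * .X + 13) + 4) + 1) + ((.X * (.X * (40 * .X + 43) + 2 + 12 * .X + 13) + 6) +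
    ((2 * .X + 1) + ((2 * .X + 1) + (2 * .X + 1)))))

theorem eval_timePoly (N : ℕ) : timePoly.eval N = timeBound N := by
  simp [timePoly, timeBound]

end EdgeElimination

open EdgeElimination in
/-- The efficient edge domination problem is solvable in polynomial time for α-acyclic
hypergraphs. -/
theorem mainTheorem6 :
    SolvableInPolyTimeOn HypergraphInstance.encode
      (fun H : HypergraphInstance => H.graph.IsAlphaAcyclic)
      (fun H : HypergraphInstance => H.graph.HasEfficientEdgeDominatingSet) := by
  classical
  refine StackProg.computableInPolyTime mainProg .inp .out (Equiv.refl _) (Equiv.refl _)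
    timePoly ?_
  rintro ⟨⟨n, m, G⟩, hG⟩
  change G.IsAlphaAcyclic at hG
  have henc : HypergraphInstance.encode ⟨n, m, G⟩ = List.replicate n (some true) ++ none ::
      ((List.finRange m).map fun e =>
        HypergraphInstance.rowCode (G.edge e) ++ [none]).flatten := by
    rw [HypergraphInstance.encode, List.ofFn_eq_map]
  have hlen : (HypergraphInstance.encode ⟨n, m, G⟩).length =
      n + 1 + (List.finRange m).length * (n + 1) := by
    rw [henc, List.length_append, List.length_cons, length_rows, List.length_replicate]
    ring
  obtain ⟨t, ht, hrun⟩ := exec_mainProg G.edge (List.finRange m) hlen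
  refine ⟨t, by rw [eval_timePoly]; exact ht, ?_⟩
  -- The reversed order of the hyperedges is immaterial, and the `m * (n + 1)` rounds performed are
  -- at least the `m` required.
  have hv := MultiHypergraph.verdict_eq_true_iff hG
    (r := meetRel fun i => rowBits (G.edge i)) (fun e f => meetBits_rowBits _ _)
    (es := (List.finRange m).reverse) (by simp) (k := (List.finRange m).length * (n + 1))
    (by simpa using Nat.le_mul_of_pos_right _ n.succ_pos)
  convert hrun using 1
  · funext k
    rw [henc]
    cases k <;> simp [Store.regs, readStore]
  · funext k
    have : decide (G.HasEfficientEdgeDominatingSet) = verdict (meetRel fun i => rowBits (G.edge i))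
        (List.finRange m).reverse ((round (meetRel fun i => rowBits (G.edge i))
        (List.finRange m).reverse)^[(List.finRange m).length * (n + 1)] fun _ => true) := by
      rw [Bool.eq_iff_iff, hv, decide_eq_true_iff]
    rw [← this]
    cases k <;> simp [Store.regs, readStore, Computability.encodeBool]
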